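/- Let $S=\Gamma\backslash\mathbb H^2$ be a closed orientable hyperbolic surface, where $\mathbb H^2$ is the hyperbolic plane with its distance $\tilde d$ and $\Gamma$ is the group of covering transformations of $\pi:\mathbb H^2\to S$. Let $f:S\to S$ be a homeomorphism isotopic to the identity and $\tilde f:\mathbb H^2\to\mathbb H^2$ its lift that commutes with every element of $\Gamma$. For $a\in\Gamma$ let $[a]$ be its class in $H_1(S,\mathbb R)=\mathbb R\otimes_{\mathbb Z}\Gamma/[\Gamma,\Gamma]$. Let $D\subset\mathbb H^2$ be a bounded measurable fundamental domain (the sets $aD$, $a\in\Gamma$, partition $\mathbb H^2$). For $y\in S$ let $\tilde y\in D$ be its lift to $D$ and $a_y\in\Gamma$ the unique element with $a_y^{-1}\tilde f(\tilde y)\in D$. The homological rotation vector of an ergodic $f$-invariant Borel probability measure $\mu$ on $S$ is $\rho_{H_1}(\mu)=\int_S[a_y]\,d\mu(y)$. For $x\in S$ and $n\in\mathbb N$ put $L_n(x)=\tilde d(\tilde x,\tilde f^n(\tilde x))$ for any lift $\tilde x$ of $x$. The rotation speed $\vartheta(x)$ is the common value of $\lim_n\frac1nL_n(x)$ and $\lim_n\frac1nL_n(f^{-n}(x))$,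 if both exist and coincide; if $\vartheta(x)$ is $\mu$-a.e. equal to a constant $\vartheta_\mu$, this constant is called the rotation speed of $\mu$. A geodesic of $S$ is a local isometry $\gamma:\mathbb R\to S$ (so it has unit speed). It is a tracking geodesic of $x$ if $\vartheta(x)>0$ and for each lift $\tilde x$ of $x$ there is a lift $\tilde\gamma$ of $\gamma$ with $$\lim_{n\to+\infty}\tfrac1n\tilde d\big(\tilde f^n(\tilde x),\tilde\gamma(n\vartheta(x))\big)=\lim_{n\to+\infty}\tfrac1n\tilde d\big(\tilde f^{-n}(\tilde x),\tilde\gamma(-n\vartheta(x))\big)=0,\qquad(*)$$ and it is normalized if moreover, for some such $\tilde x$ and $\tilde\gamma$, the point $\tilde\gamma(0)$ is the point of $\tilde\gamma(\mathbb R)$ closest to $\tilde x$. For a bounded fundamental domain $E$ and a curve $\tilde\gamma$ in $\mathbb H^2$ let $[\tilde\gamma|_{[0,t]}]=[a]$, where $a\in\Gamma$ is the unique element such that $ba^{-1}\tilde\gamma(t)\in E$ and $b\tilde\gamma(0)\in E$ for some $b\in\Gamma$; the asymptotic homology class of $\tilde\gamma$ is $[\tilde\gamma]=\lim_{t\to+\infty}\frac1t[\tilde\gamma|_{[0,t]}]$,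 when the limit exists. **Proposition.** If $\mu$ is an ergodic $f$-invariant Borel probability measure with $\rho_{H_1}(\mu)\neq0$, then $\mu$ has a rotation speed $\vartheta_\mu$ and $\vartheta_\mu>0$. Furthermore, for $\mu$-almost every $x\in S$, the point $x$ has a normalized tracking geodesic, and for every tracking geodesic $\gamma$ of $x$, every lift $\tilde x$ of $x$ and every lift $\tilde\gamma$ of $\gamma$ that satisfies $(*)$, the class $[\tilde\gamma]$ exists (for every choice of $E$) and $$\rho_{H_1}(\mu)=\vartheta_\mu\,[\tilde\gamma].$$ Equivalently, $\rho_{H_1}(\mu)$ is the asymptotic homology class of the tracking geodesic parametrized with speed $\vartheta_\mu$, that is, of $t\mapsto\tilde\gamma(\vartheta_\mu t)$. -/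

import Mathlib

open UpperHalfPlane Filter Topology MeasureTheory
open scoped MatrixGroups TensorProduct

noncomputable section

namespace TrackingGeodesics

/-- The group `Γ`, acting on the hyperbolic plane `ℍ` (with its metric of curvature `-1`), is the
group of covering transformations of a closed orientable hyperbolic surface: it acts by
orientation preserving isometries (Moebius transformations), freely, properly discontinuously and
cocompactly. -/
structure IsClosedSurfaceGroup (Γ : Type*) [Group Γ] [MulAction Γ ℍ] : Prop where
  moebius : ∀ g : Γ, ∃ A : SL(2, ℝ), ∀ z : ℍ, g • z = A • z
  free : ∀ (g : Γ) (z : ℍ), g • z = z → g = 1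
  properlyDiscontinuous : ∀ K : Set ℍ, IsCompact K →
    {g : Γ | ∃ z ∈ K, g • z ∈ K}.Finite
  cocompact : ∃ K : Set ℍ, IsCompact K ∧ ∀ z : ℍ, ∃ g : Γ, g • z ∈ K

section Surface

variable (Γ : Type*) [Group Γ] [MulAction Γ ℍ]

/-- The surface `S = Γ \ ℍ`, with the quotient topology and its Borel sets. -/
def Surface : Type := MulAction.orbitRel.Quotient Γ ℍ

instance : TopologicalSpace (Surface Γ) :=
  inferInstanceAs (TopologicalSpace (Quotient (MulAction.orbitRel Γ ℍ)))

instance : MeasurableSpace (Surface Γ) := borel _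

instance : BorelSpace (Surface Γ) := ⟨rfl⟩

/-- The covering projection `ℍ → S`. -/
def proj (z : ℍ) : Surface Γ := Quotient.mk (MulAction.orbitRel Γ ℍ) z

/-- The distance on `S` whose lift is the hyperbolic distance: the smallest distance between
lifts. -/
def surfaceDist (p q : Surface Γ) : ℝ :=
  sInf {r : ℝ | ∃ z w : ℍ, proj Γ z = p ∧ proj Γ w = q ∧ r = dist z w}

end Surface

section Homology

variable (Γ : Type*) [Group Γ]

/-- The real homology `H₁(S, ℝ) = ℝ ⊗_ℤ Γ / [Γ, Γ]`. -/
def H1 : Type _ := ℝ ⊗[ℤ] (Additive (Abelianization Γ))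

instance : AddCommGroup (H1 Γ) :=
  inferInstanceAs (AddCommGroup (ℝ ⊗[ℤ] (Additive (Abelianization Γ))))

instance : Module ℝ (H1 Γ) :=
  inferInstanceAs (Module ℝ (ℝ ⊗[ℤ] (Additive (Abelianization Γ))))

/-- Coordinates of a homology class in some fixed basis. -/
def H1.coords : H1 Γ ≃ₗ[ℝ] (Module.Basis.ofVectorSpaceIndex ℝ (H1 Γ) →₀ ℝ) :=
  (Module.Basis.ofVectorSpace ℝ (H1 Γ)).repr

/-- The sum of the absolute values of the coordinates in some fixed basis. For a surface group
`H₁` is finite dimensional, so that all norms on it are equivalent and any of them may be used to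
speak of limits and integrals. -/
def H1.l1Norm : AddGroupNorm (H1 Γ) where
  toFun v := (H1.coords Γ v).sum fun _ r => |r|
  map_zero' := by simp
  add_le' v w := by
    classical
    rw [map_add,
      Finsupp.sum_of_support_subset (H1.coords Γ v + H1.coords Γ w)
        (s := (H1.coords Γ v).support ∪ (H1.coords Γ w).support)
        Finsupp.support_add _ (by simp),
      Finsupp.sum_of_support_subset (H1.coords Γ v)
        (s := (H1.coords Γ v).support ∪ (H1.coords Γ w).support)
        Finset.subset_union_left _ (by simp),
      Finsupp.sum_of_support_subset (H1.coords Γ w)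
        (s := (H1.coords Γ v).support ∪ (H1.coords Γ w).support)
        Finset.subset_union_right _ (by simp),
      ← Finset.sum_add_distrib]
    exact Finset.sum_le_sum fun i _ => abs_add_le _ _
  neg' v := by
    rw [map_neg]
    simp [Finsupp.sum]
  eq_zero_of_map_eq_zero' v hv := by
    have hv' : ∑ i ∈ (H1.coords Γ v).support, |H1.coords Γ v i| = 0 := hv
    rw [Finset.sum_eq_zero_iff_of_nonneg fun i _ => abs_nonneg _] at hv'
    have h0 : H1.coords Γ v = 0 := by
      ext i
      by_cases hi : i ∈ (H1.coords Γ v).support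
      · simpa using hv' i hi
      · simpa using hi
    simpa using h0

instance : NormedAddCommGroup (H1 Γ) := (H1.l1Norm Γ).toNormedAddCommGroup

instance : NormedSpace ℝ (H1 Γ) where
  norm_smul_le a v := by
    change (H1.coords Γ (a • v)).sum (fun _ r => |r|) ≤
      |a| * (H1.coords Γ v).sum (fun _ r => |r|)
    rw [map_smul, Finsupp.sum_smul_index' (by simp), Finsupp.mul_sum]
    simp [abs_mul]

variable {Γ}

/-- The homology class `[a]` of a covering transformation `a`. -/
def homologyClass (a : Γ) : H1 Γ :=
  (1 : ℝ) ⊗ₜ[ℤ] Additive.ofMul (Abelianization.of a)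

end Homology

section FundamentalDomains

variable {Γ : Type*} [Group Γ] [MulAction Γ ℍ]

variable (Γ) in
/-- `D` is a bounded fundamental domain: its translates by `Γ` partition `ℍ`. -/
structure IsBoundedFundamentalDomain (D : Set ℍ) : Prop where
  bounded : Bornology.IsBounded D
  partition : ∀ z : ℍ, ∃! g : Γ, g⁻¹ • z ∈ D

/-- The unique `a ∈ Γ` with `a⁻¹ z ∈ D`. -/
def tile (D : Set ℍ) (z : ℍ) : Γ := Classical.epsilon fun a : Γ => a⁻¹ • z ∈ D

/-- The lift to `D` of a point of the surface. -/
def liftTo (D : Set ℍ) (y : Surface Γ) : ℍ := Classical.epsilon fun z => z ∈ D ∧ proj Γ z = y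

end FundamentalDomains

section Dynamics

variable {Γ : Type*} [Group Γ] [MulAction Γ ℍ]

/-- `f` is isotopic to the identity. -/
def IsotopicToId (f : Surface Γ ≃ₜ Surface Γ) : Prop :=
  ∃ F : unitInterval → (Surface Γ ≃ₜ Surface Γ),
    (Continuous fun p : unitInterval × Surface Γ => F p.1 p.2) ∧
    (∀ x, F 0 x = x) ∧ ∀ x, F 1 x = f x

/-- `ft` is the preferred lift of `f`: it lifts `f` and commutes with all covering
transformations. -/
def IsPreferredLift (f : Surface Γ ≃ₜ Surface Γ) (ft : ℍ ≃ₜ ℍ) : Prop :=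
  (∀ z, proj Γ (ft z) = f (proj Γ z)) ∧ ∀ (g : Γ) (z : ℍ), ft (g • z) = g • ft z

/-- The element `a_y ∈ Γ` with `a_y⁻¹ ft(y') ∈ D`, for `y'` the lift of `y` to `D`. -/
def rotationCocycle (D : Set ℍ) (ft : ℍ ≃ₜ ℍ) (y : Surface Γ) : Γ := tile D (ft (liftTo D y))

/-- The homological rotation vector `ρ(μ) = ∫ [a_y] dμ(y)`. -/
def rotationVector (D : Set ℍ) (ft : ℍ ≃ₜ ℍ) (μ : Measure (Surface Γ)) : H1 Γ :=
  ∫ y, homologyClass (rotationCocycle D ft y) ∂μ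

/-- The rotation distance `L_n(x)`: the distance of `x'` to `ft^n(x')`, for `x'` any lift of `x`. -/
def rotationDist (ft : ℍ ≃ₜ ℍ) (n : ℕ) (x : Surface Γ) : ℝ :=
  dist (Quotient.out x : ℍ) (ft^[n] (Quotient.out x))

/-- The point `x` has rotation speed `v`: both `L_n(x) / n` and `L_n(f⁻ⁿ(x)) / n` tend to `v`. -/
def HasRotationSpeed (f : Surface Γ ≃ₜ Surface Γ) (ft : ℍ ≃ₜ ℍ) (x : Surface Γ) (v : ℝ) : Prop :=
  Tendsto (fun n : ℕ => rotationDist ft n x / n) atTop (𝓝 v) ∧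
  Tendsto (fun n : ℕ => rotationDist ft n (f.symm^[n] x) / n) atTop (𝓝 v)

/-- The measure `μ` has rotation speed `v`. -/
def MeasureHasRotationSpeed (f : Surface Γ ≃ₜ Surface Γ) (ft : ℍ ≃ₜ ℍ)
    (μ : Measure (Surface Γ)) (v : ℝ) : Prop :=
  ∀ᵐ x ∂μ, HasRotationSpeed f ft x v

/-- A geodesic of `S`: a local isometry `ℝ → S`. -/
def IsGeodesic (γ : ℝ → Surface Γ) : Prop :=
  ∀ t : ℝ, ∃ ε > 0, ∀ s s' : ℝ, |s - t| < ε → |s' - t| < ε →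
    surfaceDist Γ (γ s) (γ s') = |s - s'|

/-- `c` is a lift of the curve `γ` to `ℍ`. -/
def IsCurveLift (γ : ℝ → Surface Γ) (c : ℝ → ℍ) : Prop :=
  Continuous c ∧ ∀ t, proj Γ (c t) = γ t

/-- The tracking equation, at speed `v`, of the orbit of `z` by the curve `c`. -/
def Tracks (ft : ℍ ≃ₜ ℍ) (z : ℍ) (c : ℝ → ℍ) (v : ℝ) : Prop :=
  Tendsto (fun n : ℕ => dist (ft^[n] z) (c (n * v)) / n) atTop (𝓝 0) ∧
  Tendsto (fun n : ℕ => dist (ft.symm^[n] z) (c (-(n * v))) / n) atTop (𝓝 0)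

/-- The point `x` has rotation speed `v > 0` and `γ` is a tracking geodesic of `x`. -/
structure IsTrackingGeodesic (f : Surface Γ ≃ₜ Surface Γ) (ft : ℍ ≃ₜ ℍ) (x : Surface Γ) (v : ℝ)
    (γ : ℝ → Surface Γ) : Prop where
  speed : HasRotationSpeed f ft x v
  speed_pos : 0 < v
  geodesic : IsGeodesic γ
  tracks : ∀ z : ℍ, proj Γ z = x → ∃ c : ℝ → ℍ, IsCurveLift γ c ∧ Tracks ft z c v

/-- `γ` is a normalized tracking geodesic of `x`: some lift of it tracks a lift `z` of `x` and has
at time `0` its point closest to `z`. -/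
def IsNormalizedTrackingGeodesic (f : Surface Γ ≃ₜ Surface Γ) (ft : ℍ ≃ₜ ℍ) (x : Surface Γ)
    (v : ℝ) (γ : ℝ → Surface Γ) : Prop :=
  IsTrackingGeodesic f ft x v γ ∧
  ∃ (z : ℍ) (c : ℝ → ℍ), proj Γ z = x ∧ IsCurveLift γ c ∧ Tracks ft z c v ∧
    dist z (c 0) = Metric.infDist z (Set.range c)

/-- The homology class relative to `D` of the curve `c` restricted to `[0, t]`: the class of the
unique `a ∈ Γ` such that `b a⁻¹ c(t) ∈ D` and `b c(0) ∈ D` for some `b ∈ Γ`. -/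
def curveClass (D : Set ℍ) (c : ℝ → ℍ) (t : ℝ) : H1 Γ :=
  homologyClass (Classical.epsilon fun a : Γ => ∃ b : Γ, (b * a⁻¹) • c t ∈ D ∧ b • c 0 ∈ D)

/-- The curve `c` has the asymptotic homology class `h`: the limit of `(1/t) [c|[0,t]]` as
`t → +∞` exists and is `h`. -/
def HasAsymptoticClass (D : Set ℍ) (c : ℝ → ℍ) (h : H1 Γ) : Prop :=
  Tendsto (fun t : ℝ => t⁻¹ • curveClass (Γ := Γ) D c t) atTop (𝓝 h)

end Dynamics

end TrackingGeodesics

end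

/-! Since `ft` commutes with Γ, its displacement is bounded and the rotation distances form a
subadditive cocycle of at most linear growth. Kingman's theorem
(`IsBoundedSubadditive.exists_tendsto_two_sided`) gives a single speed v for future and past. The
elements a_y take finitely many values and are the increments of the tiles that an orbit visits, so
by Birkhoff's theorem the homology class of the tile of ft^n(z) is nρ + o(n), and that of ft^(-n)(z)
is -nρ + o(n).

Homology is tied to distance by the comparison of word length with displacement: the classes of the
tiles of two points differ by at most a multiple of their distance plus a constant
(`IsBoundedFundamentalDomain.exists_norm_tile_sub_tile_le`). Hence ‖ρ‖ ≤ M v, so v > 0, and two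
sequences at sublinear distance have the same homological drift.

Negative curvature supplies the geodesic. Far from the base point, at distance r, a bounded step
moves the Klein coordinate by O(e^(-r)), so a half orbit of speed v > 0 converges to a point of the
circle at exponential rate almost v (`exists_convergesAtSpeed`). Two sequences with the same speed
and the same end are at sublinear distance. If the two half orbits had a common end, then ρ = -ρ; so
the ends differ, and the line joining them tracks both half orbits (`exists_tracking_line`).

Any tracking lift at time nv is within o(n) of the orbit and inherits its drift; being 1-Lipschitz,
it has the same drift along real times (`hasAsymptoticClass_of_tracks`). -/

namespace TrackingGeodesics

/-! ### Birkhoff's and Kingman's theorems for bounded cocycles -/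

section SubadditiveErgodic

variable {X : Type*} [MeasurableSpace X]

/-- A nonnegative measurable subadditive cocycle over `T`, growing at most linearly. -/
structure IsBoundedSubadditive (T : X → X) (C : ℝ) (a : ℕ → X → ℝ) : Prop where
  measurable : ∀ n, Measurable (a n)
  nonneg : ∀ n x, 0 ≤ a n x
  le : ∀ n x, a n x ≤ n * C
  subadd : ∀ m n x, a (m + n) x ≤ a m x + a n (T^[m] x)

theorem measurable_birkhoffSum {T : X → X} (hT : Measurable T) {g : X → ℝ} (hg : Measurable g)
    (n : ℕ) : Measurable (birkhoffSum T g n) :=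
  Finset.measurable_fun_sum _ fun k _ => hg.comp (hT.iterate k)

theorem isBoundedSubadditive_birkhoffSum {T : X → X} (hT : Measurable T) {g : X → ℝ}
    (hg : Measurable g) {C : ℝ} (h0 : ∀ x, 0 ≤ g x) (hC : ∀ x, g x ≤ C) :
    IsBoundedSubadditive T C (birkhoffSum T g) where
  measurable := measurable_birkhoffSum hT hg
  nonneg _ _ := Finset.sum_nonneg fun _ _ => h0 _
  le n x := by
    have := Finset.sum_le_card_nsmul (Finset.range n) (fun k => g (T^[k] x)) C fun _ _ => hC _
    simpa [birkhoffSum] using this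
  subadd m n x := (birkhoffSum_add T g m n x).le

theorem integral_comp_of_measurePreserving {E : Type*} [NormedAddCommGroup E] [NormedSpace ℝ E]
    {μ : Measure X} {T : X → X} (hT : MeasurePreserving T μ μ) {g : X → E}
    (hg : AEStronglyMeasurable g μ) :
    ∫ x, g (T x) ∂μ = ∫ x, g x ∂μ := by
  have h := integral_map (μ := μ) hT.measurable.aemeasurable (f := g) (by rwa [hT.map_eq])
  rw [← h, hT.map_eq]

theorem integrable_of_bounded {μ : Measure X} [IsProbabilityMeasure μ] {g : X → ℝ}
    (hg : Measurable g) {C : ℝ} (h0 : ∀ x, 0 ≤ g x) (hC : ∀ x, g x ≤ C) : Integrable g μ :=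
  Integrable.of_bound hg.aestronglyMeasurable C (ae_of_all _ fun x => by
    rw [Real.norm_eq_abs, abs_of_nonneg (h0 x)]; exact hC x)

theorem integral_birkhoffSum {μ : Measure X} [IsProbabilityMeasure μ] {T : X → X}
    (hT : MeasurePreserving T μ μ) {g : X → ℝ} (hg : Measurable g) {C : ℝ} (h0 : ∀ x, 0 ≤ g x)
    (hC : ∀ x, g x ≤ C) (n : ℕ) :
    ∫ x, birkhoffSum T g n x ∂μ = n * ∫ x, g x ∂μ := by
  have h : ∀ k, ∫ x, g (T^[k] x) ∂μ = ∫ x, g x ∂μ := fun k =>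
    integral_comp_of_measurePreserving (hT.iterate k) hg.aestronglyMeasurable
  simp only [birkhoffSum]
  rw [integral_finsetSum (f := fun k x => g (T^[k] x)) _ fun k _ => integrable_of_bounded
    (hg.comp (hT.measurable.iterate k)) (fun x => h0 _) (fun x => hC _)]
  simp [h]

/-- A bounded function that does not decrease along the orbits is constant almost everywhere. -/
theorem ae_const_of_le_comp {μ : Measure X} [IsProbabilityMeasure μ] {T : X → X}
    (hT : Ergodic T μ) {g : X → ℝ} (hg : Measurable g) {C : ℝ} (h0 : ∀ x, 0 ≤ g x)
    (hC : ∀ x, g x ≤ C) (h : ∀ x, g x ≤ g (T x)) : ∃ c, ∀ᵐ x ∂μ, g x = c := by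
  have hi := integrable_of_bounded (μ := μ) hg h0 hC
  have hi' := integrable_of_bounded (μ := μ) (hg.comp hT.measurable) (fun x => h0 _)
    (fun x => hC _)
  have hint : ∫ x, (g (T x) - g x) ∂μ = 0 := by
    have := integral_sub hi' hi
    simp only [Function.comp_apply] at this
    rw [this, integral_comp_of_measurePreserving hT.toMeasurePreserving hg.aestronglyMeasurable,
      sub_self]
  have hz := (integral_eq_zero_iff_of_nonneg (fun x => sub_nonneg.2 (h x)) (hi'.sub hi)).1 hint
  have heq : g ∘ T =ᵐ[μ] g := by
    filter_upwards [hz] with x hx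
    simpa [sub_eq_zero] using hx
  exact hT.ae_eq_const_of_ae_eq_comp_ae hg.aestronglyMeasurable heq

variable {T : X → X} {C : ℝ} {a : ℕ → X → ℝ}

/-- The greedy covering of an orbit segment by blocks on which the cocycle is small. -/
theorem IsBoundedSubadditive.le_of_good_times (ha : IsBoundedSubadditive T C a) (hC : 0 ≤ C)
    {κ : ℝ} (hκ : 0 ≤ κ) {M : ℕ} {B : Set X}
    (hB : ∀ x ∉ B, ∃ m, 1 ≤ m ∧ m ≤ M ∧ a m x ≤ m * κ) (n : ℕ) (x : X) :
    a n x ≤ n * κ + C * birkhoffSum T (B.indicator 1) n x + M * C := by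
  have hpos : ∀ (m : ℕ) (y : X), 0 ≤ birkhoffSum T (B.indicator (1 : X → ℝ)) m y := fun m y =>
    Finset.sum_nonneg fun _ _ => Set.indicator_nonneg (fun _ _ => zero_le_one) _
  induction n using Nat.strong_induction_on generalizing x with
  | _ n ih =>
    -- The last, short segment is paid by `M * C`. Otherwise a step from a point of `B` costs `C`,
    -- charged to that visit, and outside `B` a whole good block of length `m ≤ M < n` is removed.
    by_cases hn : n ≤ M
    · have h1 := ha.le n x
      have h2 : (n : ℝ) * C ≤ M * C := by gcongr
      have h3 := mul_nonneg hC (hpos n x)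
      have h4 : 0 ≤ (n : ℝ) * κ := by positivity
      linarith
    · push Not at hn
      by_cases hx : x ∈ B
      · obtain ⟨k, rfl⟩ : ∃ k, n = k + 1 := ⟨n - 1, by omega⟩
        have h1 := ha.subadd 1 k x
        have h2 := ha.le 1 x
        have h3 := ih k (by omega) (T x)
        rw [birkhoffSum_succ']
        rw [add_comm 1 k] at h1
        simp only [Function.iterate_one, Nat.cast_one, one_mul] at h1 h2
        simp only [Set.indicator_of_mem hx, Pi.one_apply]
        push_cast
        nlinarith
      · obtain ⟨m, hm1, hmM, hm⟩ := hB x hx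
        obtain ⟨k, rfl⟩ : ∃ k, n = m + k := ⟨n - m, by omega⟩
        have h1 := ha.subadd m k x
        have h3 := ih k (by omega) (T^[m] x)
        rw [birkhoffSum_add]
        have h4 := mul_nonneg hC (hpos m x)
        push_cast
        nlinarith

/-- The lower growth rate of a cocycle. -/
noncomputable def lowerRate (a : ℕ → X → ℝ) (x : X) : ℝ := liminf (fun n : ℕ => a n x / n) atTop

namespace IsBoundedSubadditive

theorem div_nonneg (ha : IsBoundedSubadditive T C a) (n : ℕ) (x : X) : 0 ≤ a n x / n :=
  _root_.div_nonneg (ha.nonneg n x) (Nat.cast_nonneg n)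

theorem div_le (ha : IsBoundedSubadditive T C a) (hC : 0 ≤ C) (n : ℕ) (x : X) :
    a n x / n ≤ C := by
  rcases Nat.eq_zero_or_pos n with rfl | hn
  · simpa using hC
  · rw [div_le_iff₀ (by exact_mod_cast hn), mul_comm]
    exact ha.le n x

theorem isBoundedUnder_ge (ha : IsBoundedSubadditive T C a) (x : X) :
    IsBoundedUnder (· ≥ ·) atTop fun n : ℕ => a n x / n :=
  isBoundedUnder_of ⟨0, fun n => ha.div_nonneg n x⟩

theorem isCoboundedUnder_ge (ha : IsBoundedSubadditive T C a) (hC : 0 ≤ C) (x : X) :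
    IsCoboundedUnder (· ≥ ·) atTop fun n : ℕ => a n x / n :=
  IsBoundedUnder.isCoboundedUnder_ge (isBoundedUnder_of ⟨C, fun n => ha.div_le hC n x⟩)

theorem lowerRate_nonneg (ha : IsBoundedSubadditive T C a) (hC : 0 ≤ C) (x : X) :
    0 ≤ lowerRate a x :=
  le_liminf_of_le (ha.isCoboundedUnder_ge hC x) (Eventually.of_forall fun n => ha.div_nonneg n x)

theorem lowerRate_le (ha : IsBoundedSubadditive T C a) (hC : 0 ≤ C) (x : X) :
    lowerRate a x ≤ C :=
  liminf_le_of_le (ha.isBoundedUnder_ge x) fun b hb => by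
    obtain ⟨n, hn⟩ := hb.exists
    exact hn.trans (ha.div_le hC n x)

/-- Subadditivity compares `a (n + 1) x` with `a n (T x)` up to `a 1 x ≤ C`, which disappears after
division by `n`. -/
theorem lowerRate_le_comp (ha : IsBoundedSubadditive T C a) (hC : 0 ≤ C) (x : X) :
    lowerRate a x ≤ lowerRate a (T x) := by
  refine le_of_forall_lt fun c hc => ?_
  obtain ⟨d, hcd, hd⟩ := exists_between hc
  obtain ⟨e, hde, he⟩ := exists_between hd
  have h1 : ∀ᶠ n : ℕ in atTop, e < a n x / n :=
    eventually_lt_of_lt_liminf he (ha.isBoundedUnder_ge x)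
  have h2 : ∀ᶠ n : ℕ in atTop, e < a (n + 1) x / (n + 1 : ℕ) :=
    (tendsto_add_atTop_nat 1).eventually h1
  have h3 : ∀ᶠ n : ℕ in atTop, (C + |e|) / (e - d) < n :=
    tendsto_natCast_atTop_atTop.eventually_gt_atTop _
  refine hcd.trans_le (le_liminf_of_le (ha.isCoboundedUnder_ge hC _) ?_)
  filter_upwards [h2, h3, eventually_gt_atTop 0] with n hn hn' hn0
  have hn0' : (0 : ℝ) < n := by exact_mod_cast hn0
  have h4 := ha.subadd 1 n x
  have h5 := ha.le 1 x
  rw [lt_div_iff₀ (by positivity)] at hn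
  rw [div_lt_iff₀ (sub_pos.2 hde)] at hn'
  rw [le_div_iff₀ hn0']
  rw [add_comm 1 n] at h4
  simp only [Function.iterate_one, Nat.cast_one, one_mul] at h4 h5
  push_cast at hn
  nlinarith [neg_abs_le e]

theorem exists_lowerRate_const {μ : Measure X} [IsProbabilityMeasure μ]
    (ha : IsBoundedSubadditive T C a) (hC : 0 ≤ C) (hT : Ergodic T μ) :
    ∃ L, ∀ᵐ x ∂μ, lowerRate a x = L :=
  ae_const_of_le_comp hT (Measurable.liminf fun n => (ha.measurable n).div_const _)
    (ha.lowerRate_nonneg hC) (ha.lowerRate_le hC) (ha.lowerRate_le_comp hC)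

/-- Outside a set of small measure, there is a block of bounded length on which the cocycle is
almost as small as its lower growth rate predicts. -/
theorem exists_good_times {μ : Measure X} [IsProbabilityMeasure μ]
    (ha : IsBoundedSubadditive T C a) (hC : 0 ≤ C) {L : ℝ}
    (hL : ∀ᵐ x ∂μ, lowerRate a x = L) {ε : ℝ} (hε : 0 < ε) :
    ∃ (M : ℕ) (B : Set X), MeasurableSet B ∧ μ.real B < ε ∧
      ∀ x ∉ B, ∃ m, 1 ≤ m ∧ m ≤ M ∧ a m x ≤ m * (L + ε) := by
  let B : ℕ → Set X := fun M => ⋂ m ∈ Finset.Icc 1 M, {x | (m : ℝ) * (L + ε) < a m x}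
  have hBm : ∀ M, MeasurableSet (B M) := fun M =>
    Finset.measurableSet_biInter _ fun m _ => measurableSet_lt measurable_const (ha.measurable m)
  have hanti : Antitone B := fun M N hMN =>
    Set.biInter_mono (fun m hm => Finset.Icc_subset_Icc_right hMN hm) fun _ _ => le_rfl
  have hnull : μ (⋂ M, B M) = 0 := by
    refine measure_eq_zero_iff_ae_notMem.2 ?_
    filter_upwards [hL] with x hx hmem
    have hfreq : ∃ᶠ n : ℕ in atTop, a n x / n < L + ε :=
      frequently_lt_of_liminf_lt (ha.isCoboundedUnder_ge hC x)
        (by change lowerRate a x < _; linarith)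
    obtain ⟨n, hn, hn1⟩ := (hfreq.and_eventually (eventually_ge_atTop 1)).exists
    have h1 : x ∈ B n := Set.mem_iInter.1 hmem n
    simp only [B, Set.mem_iInter, Finset.mem_Icc, Set.mem_ofPred_eq] at h1
    have h2 := h1 n ⟨hn1, le_rfl⟩
    rw [div_lt_iff₀ (by exact_mod_cast hn1)] at hn
    linarith
  have htend := tendsto_measure_iInter_atTop (μ := μ) (fun i => (hBm i).nullMeasurableSet) hanti
    ⟨0, measure_ne_top _ _⟩
  rw [hnull] at htend
  obtain ⟨M, hM⟩ := (htend.eventually_lt_const (ENNReal.ofReal_pos.2 hε)).exists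
  refine ⟨M, B M, hBm M, ?_, fun x hx => ?_⟩
  · rw [Measure.real]
    exact (ENNReal.lt_ofReal_iff_toReal_lt (measure_ne_top _ _)).1 hM
  · simp only [B, Set.mem_iInter, Finset.mem_Icc, Set.mem_ofPred_eq] at hx
    push Not at hx
    obtain ⟨m, ⟨h1, h2⟩, h3⟩ := hx
    exact ⟨m, h1, h2, h3⟩

/-- Integrate the greedy covering bound: by invariance the mean number of visits to the bad set is
`n * μ.real B`, which is at most `n * ε`. -/
theorem integral_le_of_lowerRate {μ : Measure X} [IsProbabilityMeasure μ]
    (ha : IsBoundedSubadditive T C a) (hC : 0 ≤ C) (hT : MeasurePreserving T μ μ) {L : ℝ}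
    (hL0 : 0 ≤ L) (hL : ∀ᵐ x ∂μ, lowerRate a x = L) {ε : ℝ} (hε : 0 < ε) :
    ∃ M : ℕ, ∀ n : ℕ, ∫ x, a n x ∂μ ≤ n * (L + ε) + C * (n * ε) + M * C := by
  obtain ⟨M, B, hBm, hBε, hB⟩ := ha.exists_good_times hC hL hε
  have hind : Measurable (B.indicator (1 : X → ℝ)) := measurable_one.indicator hBm
  have hind0 : ∀ x, 0 ≤ B.indicator (1 : X → ℝ) x := fun x =>
    Set.indicator_nonneg (fun _ _ => zero_le_one) _
  have hind1 : ∀ x, B.indicator (1 : X → ℝ) x ≤ 1 := fun x =>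
    Set.indicator_le_self' (fun _ _ => zero_le_one) x
  refine ⟨M, fun n => ?_⟩
  have hS := isBoundedSubadditive_birkhoffSum hT.measurable hind hind0 hind1
  have hSi : Integrable (birkhoffSum T (B.indicator (1 : X → ℝ)) n) μ :=
    integrable_of_bounded (hS.measurable n) (hS.nonneg n) (hS.le n)
  calc ∫ x, a n x ∂μ
      ≤ ∫ x, (n * (L + ε) + C * birkhoffSum T (B.indicator 1) n x + M * C) ∂μ :=
        integral_mono (integrable_of_bounded (ha.measurable n) (ha.nonneg n) (ha.le n))
          (((integrable_const _).add (hSi.const_mul C)).add (integrable_const _))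
          fun x => ha.le_of_good_times hC (by positivity) hB n x
    _ = n * (L + ε) + C * (n * μ.real B) + M * C := by
        have h1 := integral_add (((integrable_const (n * (L + ε))).add (hSi.const_mul C)))
          (integrable_const (μ := μ) (M * C))
        have h2 := integral_add (integrable_const (μ := μ) (n * (L + ε))) (hSi.const_mul C)
        simp only [Pi.add_apply] at h1 h2
        rw [h1, h2, integral_const_mul C, integral_birkhoffSum hT hind hind0 hind1,
          integral_indicator_one hBm]
        simp
    _ ≤ _ := by gcongr

end IsBoundedSubadditive

/-- One half of Birkhoff's theorem. For an additive cocycle the mean is exactly `n` times the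
integral; divide the covering bound by `n`, let `n` tend to infinity, then `ε` to zero. -/
theorem integral_le_of_lowerRate_birkhoffSum {μ : Measure X} [IsProbabilityMeasure μ]
    (hT : Ergodic T μ) {g : X → ℝ} (hg : Measurable g) (h0 : ∀ x, 0 ≤ g x) (hC : ∀ x, g x ≤ C) :
    ∀ᵐ x ∂μ, ∫ y, g y ∂μ ≤ lowerRate (birkhoffSum T g) x := by
  have hS := isBoundedSubadditive_birkhoffSum hT.measurable hg h0 hC
  obtain ⟨x₀⟩ : Nonempty X := nonempty_of_isProbabilityMeasure μ
  have hC0 : 0 ≤ C := (h0 x₀).trans (hC x₀)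
  obtain ⟨L, hL⟩ := hS.exists_lowerRate_const hC0 hT
  have hL0 : 0 ≤ L := by
    obtain ⟨x, hx⟩ := hL.exists
    exact hx ▸ hS.lowerRate_nonneg hC0 x
  have key : ∫ y, g y ∂μ ≤ L := by
    have hε : ∀ ε > 0, ∫ y, g y ∂μ ≤ L + ε * (1 + C) := fun ε hε => by
      obtain ⟨M, hM⟩ := hS.integral_le_of_lowerRate hC0 hT.toMeasurePreserving hL0 hL hε
      have h1 : ∀ᶠ n : ℕ in atTop, ∫ y, g y ∂μ ≤ L + ε * (1 + C) + (M * C) / n := by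
        filter_upwards [eventually_gt_atTop 0] with n hn
        have h2 := hM n
        rw [integral_birkhoffSum hT.toMeasurePreserving hg h0 hC] at h2
        have hn' : (0 : ℝ) < n := by exact_mod_cast hn
        have h3 : ∫ y, g y ∂μ ≤ (n * (L + ε) + C * (n * ε) + M * C) / n := by
          rw [le_div_iff₀ hn']; linarith
        refine h3.trans_eq ?_
        field_simp
        ring
      have h4 : Tendsto (fun n : ℕ => L + ε * (1 + C) + (M * C) / n) atTop
          (𝓝 (L + ε * (1 + C) + 0)) :=
        tendsto_const_nhds.add (tendsto_const_div_atTop_nhds_zero_nat _)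
      simpa using ge_of_tendsto h4 h1
    have h5 : Tendsto (fun ε : ℝ => L + ε * (1 + C)) (𝓝[>] 0) (𝓝 (L + 0 * (1 + C))) :=
      ((Continuous.tendsto (by fun_prop) 0).mono_left nhdsWithin_le_nhds)
    simpa using ge_of_tendsto h5 (eventually_mem_nhdsWithin.mono hε)
  filter_upwards [hL] with x hx
  rwa [hx]

/-- Birkhoff's ergodic theorem for bounded nonnegative functions and ergodic maps. -/
theorem tendsto_birkhoffSum_div {μ : Measure X} [IsProbabilityMeasure μ]
    (hT : Ergodic T μ) {g : X → ℝ} (hg : Measurable g) (h0 : ∀ x, 0 ≤ g x) (hC : ∀ x, g x ≤ C) :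
    ∀ᵐ x ∂μ, Tendsto (fun n : ℕ => birkhoffSum T g n x / n) atTop (𝓝 (∫ y, g y ∂μ)) := by
  have h1 := integral_le_of_lowerRate_birkhoffSum hT hg h0 hC
  -- The upper half of the limit is the lower half for `C - g`.
  have hg0' : ∀ x, 0 ≤ C - g x := fun x => sub_nonneg.2 (hC x)
  have hg1' : ∀ x, C - g x ≤ C := fun x => sub_le_self _ (h0 x)
  have hgm' : Measurable fun x => C - g x := measurable_const.sub hg
  have h2 := integral_le_of_lowerRate_birkhoffSum hT hgm' hg0' hg1'
  have hS := isBoundedSubadditive_birkhoffSum hT.measurable hg h0 hC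
  have hS' := isBoundedSubadditive_birkhoffSum hT.measurable hgm' hg0' hg1'
  rw [integral_sub (integrable_const _) (integrable_of_bounded hg h0 hC)] at h2
  simp only [integral_const, probReal_univ, one_smul] at h2
  filter_upwards [h1, h2] with x hx hx'
  refine tendsto_order.2 ⟨fun c hc => ?_, fun c hc => ?_⟩
  · exact eventually_lt_of_lt_liminf (hc.trans_le hx) (hS.isBoundedUnder_ge x)
  · have h3 : C - c < lowerRate (birkhoffSum T fun x => C - g x) x := by linarith
    filter_upwards [eventually_lt_of_lt_liminf h3 (hS'.isBoundedUnder_ge x),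
      eventually_gt_atTop 0] with n hn hn0
    have hn' : (0 : ℝ) < n := by exact_mod_cast hn0
    have h4 : birkhoffSum T (fun x => C - g x) n x = n * C - birkhoffSum T g n x := by
      simp [birkhoffSum]
    rw [h4, lt_div_iff₀ hn'] at hn
    rw [div_lt_iff₀ hn']
    linarith

/-- Kingman's ergodic theorem for nonnegative cocycles of at most linear growth and ergodic
maps. -/
theorem IsBoundedSubadditive.exists_tendsto {μ : Measure X} [IsProbabilityMeasure μ]
    (ha : IsBoundedSubadditive T C a) (hT : Ergodic T μ) :
    ∃ L, ∀ᵐ x ∂μ, Tendsto (fun n : ℕ => a n x / n) atTop (𝓝 L) := by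
  obtain ⟨x₀⟩ : Nonempty X := nonempty_of_isProbabilityMeasure μ
  have hC0 : 0 ≤ C := by simpa using (ha.nonneg 1 x₀).trans (ha.le 1 x₀)
  obtain ⟨L, hL⟩ := ha.exists_lowerRate_const hC0 hT
  have hL0 : 0 ≤ L := by
    obtain ⟨x, hx⟩ := hL.exists
    exact hx ▸ ha.lowerRate_nonneg hC0 x
  -- The excess `ε * (2 + C)` collects `ε` from the good blocks, `C * ε` from the visits to `B`, and
  -- `ε` from `M * C / n`.
  have upper : ∀ ε > 0, ∀ᵐ x ∂μ, ∀ᶠ n : ℕ in atTop, a n x / n < L + ε * (2 + C) := fun ε hε => by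
    obtain ⟨M, B, hBm, hBε, hB⟩ := ha.exists_good_times hC0 hL hε
    have hind : Measurable (B.indicator (1 : X → ℝ)) := measurable_one.indicator hBm
    have hb := tendsto_birkhoffSum_div hT hind
      (fun x => Set.indicator_nonneg (fun _ _ => zero_le_one) _)
      (fun x => Set.indicator_le_self' (fun _ _ => zero_le_one) x)
    rw [integral_indicator_one hBm] at hb
    filter_upwards [hb] with x hx
    have hM : Tendsto (fun n : ℕ => (M * C) / (n : ℝ)) atTop (𝓝 0) :=
      tendsto_const_div_atTop_nhds_zero_nat _
    filter_upwards [hx.eventually_lt_const hBε, hM.eventually_lt_const hε,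
      eventually_gt_atTop 0] with n hn hn' hn0
    have hn0' : (0 : ℝ) < n := by exact_mod_cast hn0
    have h1 := ha.le_of_good_times hC0 (by positivity) hB n x
    rw [div_lt_iff₀ hn0'] at hn hn' ⊢
    nlinarith
  have hk : ∀ k : ℕ, (0 : ℝ) < 1 / (k + 1) := fun k => Nat.one_div_pos_of_nat
  have hall := ae_all_iff.2 fun k : ℕ => upper _ (hk k)
  refine ⟨L, ?_⟩
  filter_upwards [hL, hall] with x hx hx'
  refine tendsto_order.2 ⟨fun c hc => ?_, fun c hc => ?_⟩
  · exact eventually_lt_of_lt_liminf (hx ▸ hc : c < lowerRate a x) (ha.isBoundedUnder_ge x)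
  · have hlim : Tendsto (fun k : ℕ => L + (1 / ((k : ℝ) + 1)) * (2 + C)) atTop
        (𝓝 (L + 0 * (2 + C))) :=
      tendsto_const_nhds.add (tendsto_one_div_add_atTop_nhds_zero_nat.mul_const _)
    simp only [zero_mul, add_zero] at hlim
    obtain ⟨k, hk⟩ := (hlim.eventually_lt_const hc).exists
    filter_upwards [hx' k] with n hn
    exact hn.trans hk

/-- Over an invertible ergodic map, a cocycle has the same growth rate along the forward orbits
and, read from their end points, along the backward orbits. -/
theorem IsBoundedSubadditive.exists_tendsto_two_sided {μ : Measure X} [IsProbabilityMeasure μ]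
    {e : X ≃ᵐ X} (ha : IsBoundedSubadditive e C a) (he : Ergodic e μ) :
    ∃ L, ∀ᵐ x ∂μ, Tendsto (fun n : ℕ => a n x / n) atTop (𝓝 L) ∧
      Tendsto (fun n : ℕ => a n (e.symm^[n] x) / n) atTop (𝓝 L) := by
  obtain ⟨x₀⟩ : Nonempty X := nonempty_of_isProbabilityMeasure μ
  have hC0 : 0 ≤ C := by simpa using (ha.nonneg 1 x₀).trans (ha.le 1 x₀)
  -- Seen from the end point, the segment of length `m + n` splits in the opposite order: its first
  -- `n` steps are the far ones.
  have hb : IsBoundedSubadditive e.symm C (fun n x => a n (e.symm^[n] x)) :=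
    { measurable := fun n => (ha.measurable n).comp (e.symm.measurable.iterate n)
      nonneg := fun n x => ha.nonneg _ _
      le := fun n x => ha.le _ _
      subadd := fun m n x => by
        have h := ha.subadd n m (e.symm^[n + m] x)
        have hinv : Function.LeftInverse e^[n] e.symm^[n] :=
          Function.LeftInverse.iterate e.apply_symm_apply n
        have h1 : e^[n] (e.symm^[n + m] x) = e.symm^[m] x := by
          rw [Function.iterate_add_apply, hinv]
        rw [h1] at h
        rw [← Function.iterate_add_apply, add_comm m n]
        linarith }
  obtain ⟨L, hL⟩ := ha.exists_tendsto he
  obtain ⟨L', hL'⟩ := hb.exists_tendsto he.symm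
  have hlim : ∀ {T : X → X} {b : ℕ → X → ℝ} {l : ℝ}, IsBoundedSubadditive T C b →
      (∀ᵐ x ∂μ, Tendsto (fun n : ℕ => b n x / n) atTop (𝓝 l)) →
      Tendsto (fun n : ℕ => ∫ x, b n x / n ∂μ) atTop (𝓝 l) := fun {T b l} hb hl => by
    have := tendsto_integral_of_dominated_convergence (μ := μ) (fun _ => C)
      (F := fun (n : ℕ) x => b n x / n) (f := fun _ => l)
      (fun n => ((hb.measurable n).div_const _).aestronglyMeasurable) (integrable_const _)
      (fun n => ae_of_all _ fun x => by
        rw [Real.norm_eq_abs, abs_of_nonneg (hb.div_nonneg n x)]; exact hb.div_le hC0 n x) hl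
    simpa using this
  -- By dominated convergence both constants are limits of the means of `a n / n`, which coincide by
  -- invariance of `μ`.
  have heq : L = L' := by
    refine tendsto_nhds_unique (hlim ha hL) ((hlim hb hL').congr fun n => ?_)
    exact integral_comp_of_measurePreserving (g := fun x => a n x / n)
      (he.symm.toMeasurePreserving.iterate n)
      ((ha.measurable n).div_const _).aestronglyMeasurable
  subst heq
  exact ⟨L, hL.and hL'⟩

end SubadditiveErgodic

/-! ### Hyperboloid and Klein coordinates -/

section Hyperboloid

/-- The time coordinate of a point of the hyperbolic plane in the hyperboloid model. -/
noncomputable def hypTime (z : ℍ) : ℝ := (z.re ^ 2 + z.im ^ 2 + 1) / (2 * z.im)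

/-- The coordinate of a point of the hyperbolic plane in the Klein model of the unit disc. -/
noncomputable def klein (z : ℍ) : ℂ :=
  ⟨(z.re ^ 2 + z.im ^ 2 - 1) / (z.re ^ 2 + z.im ^ 2 + 1), 2 * z.re / (z.re ^ 2 + z.im ^ 2 + 1)⟩

/-- Minus the Lorentz product of the vectors `(1, u)` and `(1, w)`. -/
def lorentz (u w : ℂ) : ℝ := 1 - u.re * w.re - u.im * w.im

theorem hypTime_pos (z : ℍ) : 0 < hypTime z := by
  have := z.im_pos
  unfold hypTime
  positivity

/-- On the hyperboloid, `z` is the vector `hypTime z` times `(1, klein z)`, and the hyperbolic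
cosine of the distance is minus the Lorentz product. -/
theorem cosh_dist_eq (z w : ℍ) :
    Real.cosh (dist z w) = hypTime z * hypTime w * lorentz (klein z) (klein w) := by
  have hz := z.im_pos
  have hw := w.im_pos
  have hz' : z.re ^ 2 + z.im ^ 2 + 1 ≠ 0 := by positivity
  have hw' : w.re ^ 2 + w.im ^ 2 + 1 ≠ 0 := by positivity
  rw [cosh_dist']
  simp only [hypTime, klein, lorentz]
  field_simp
  ring

theorem norm_klein_sq (z : ℍ) : ‖klein z‖ ^ 2 = 1 - 1 / hypTime z ^ 2 := by
  have hz := z.im_pos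
  have hz' : z.re ^ 2 + z.im ^ 2 + 1 ≠ 0 := by positivity
  rw [Complex.sq_norm, Complex.normSq_apply]
  simp only [hypTime, klein]
  field_simp
  ring

theorem hypTime_eq_cosh (z : ℍ) : hypTime z = Real.cosh (dist I z) := by
  have hz := z.im_pos
  rw [cosh_dist']
  simp [hypTime]
  ring

/-- Near the unit circle the Lorentz product is thus about half the squared Euclidean distance, so
estimates in the disc turn into hyperbolic ones. -/
theorem norm_sub_sq_eq (u w : ℂ) :
    ‖u - w‖ ^ 2 = 2 * lorentz u w - (1 - ‖u‖ ^ 2) - (1 - ‖w‖ ^ 2) := by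
  simp only [Complex.sq_norm, Complex.normSq_apply, lorentz, Complex.sub_re, Complex.sub_im]
  ring

theorem lorentz_le_two {u w : ℂ} (hu : ‖u‖ ≤ 1) (hw : ‖w‖ ≤ 1) : lorentz u w ≤ 2 := by
  have h := norm_sub_sq_eq u w
  have h1 : ‖u - w‖ ≤ ‖u‖ + ‖w‖ := norm_sub_le u w
  have h2 := norm_nonneg u
  have h3 := norm_nonneg w
  have h4 := norm_nonneg (u - w)
  nlinarith

theorem norm_klein_le_one (z : ℍ) : ‖klein z‖ ≤ 1 := by
  have h := norm_klein_sq z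
  have h1 := hypTime_pos z
  have h2 : 0 < 1 / hypTime z ^ 2 := by positivity
  nlinarith [norm_nonneg (klein z)]

/-- The coordinates are inverted by `x₀ - x₁ = 1 / z.im` and `x₂ = z.re / z.im`. -/
theorem exists_hyperboloid_point {x₀ x₁ x₂ : ℝ} (h0 : 0 < x₀) (h : x₀ ^ 2 = 1 + x₁ ^ 2 + x₂ ^ 2) :
    ∃ z : ℍ, hypTime z = x₀ ∧ hypTime z * (klein z).re = x₁ ∧ hypTime z * (klein z).im = x₂ := by
  have hpos : 0 < x₀ - x₁ := by
    by_contra hneg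
    push Not at hneg
    nlinarith [sq_nonneg x₂]
  have hne : x₀ - x₁ ≠ 0 := hpos.ne'
  let z : ℍ := ⟨⟨x₂ / (x₀ - x₁), 1 / (x₀ - x₁)⟩, by simpa using hpos⟩
  have hre : z.re = x₂ / (x₀ - x₁) := rfl
  have him : z.im = 1 / (x₀ - x₁) := rfl
  have h1 : z.re ^ 2 + z.im ^ 2 = (x₀ + x₁) / (x₀ - x₁) := by
    rw [hre, him]
    field_simp
    linarith
  have h2 : z.re ^ 2 + z.im ^ 2 + 1 = 2 * x₀ / (x₀ - x₁) := by
    rw [h1]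
    field_simp
    ring
  have h3 : z.re ^ 2 + z.im ^ 2 - 1 = 2 * x₁ / (x₀ - x₁) := by
    rw [h1]
    field_simp
    ring
  have h0' := h0.ne'
  refine ⟨z, ?_, ?_, ?_⟩ <;> simp only [hypTime, klein, h2, h3] <;> rw [him] <;>
    first | rw [hre] | skip
  all_goals field_simp

/-- The distance from a point to another one given by its hyperboloid coordinates. -/
theorem cosh_dist_eq_of_coords {z w : ℍ} {x₀ x₁ x₂ : ℝ} (h0 : hypTime w = x₀)
    (h1 : hypTime w * (klein w).re = x₁) (h2 : hypTime w * (klein w).im = x₂) :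
    Real.cosh (dist z w) = hypTime z * (x₀ - (klein z).re * x₁ - (klein z).im * x₂) := by
  rw [cosh_dist_eq, ← h0, ← h1, ← h2, lorentz]
  ring

theorem eq_of_cosh_eq {x y : ℝ} (hx : 0 ≤ x) (hy : 0 ≤ y) (h : Real.cosh x = Real.cosh y) :
    x = y :=
  Real.cosh_strictMonoOn.injOn hx hy h

/-- The hyperbolic plane is a geodesic space. -/
theorem exists_dist_eq_of_le_dist (z w : ℍ) {s : ℝ} (hs0 : 0 ≤ s) (hs : s ≤ dist z w) :
    ∃ m : ℍ, dist z m = s ∧ dist m w = dist z w - s := by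
  set d := dist z w with hd
  rcases hs0.eq_or_lt with rfl | hs1
  · exact ⟨z, by simp, by simp [hd]⟩
  have hd0 : 0 < d := hs1.trans_le hs
  have hsd : 0 < Real.sinh d := Real.sinh_pos_iff.2 hd0
  have hss : 0 < Real.sinh s := Real.sinh_pos_iff.2 hs1
  have hsr : 0 ≤ Real.sinh (d - s) := Real.sinh_nonneg_iff.2 (by linarith)
  -- The point sought is the combination of the hyperboloid vectors of `z` and `w` with weights `α`
  -- and `β`. Below, `e3` puts it on the hyperboloid, and `e1` and `e2` give its distances to `z`
  -- and `w`.
  set α := Real.sinh (d - s) / Real.sinh d with hα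
  set β := Real.sinh s / Real.sinh d with hβ
  have hα0 : 0 ≤ α := by positivity
  have hβ0 : 0 < β := by positivity
  have hz := hypTime_pos z
  have hw := hypTime_pos w
  have hcosh := cosh_dist_eq z w
  rw [← hd] at hcosh
  have hnz := norm_klein_sq z
  have hnw := norm_klein_sq w
  rw [Complex.sq_norm, Complex.normSq_apply] at hnz hnw
  have hnz' : hypTime z ^ 2 - (hypTime z * (klein z).re) ^ 2 - (hypTime z * (klein z).im) ^ 2
      = 1 := by
    have : hypTime z ^ 2 * (1 / hypTime z ^ 2) = 1 := by field_simp
    linear_combination this - hypTime z ^ 2 * hnz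
  have hnw' : hypTime w ^ 2 - (hypTime w * (klein w).re) ^ 2 - (hypTime w * (klein w).im) ^ 2
      = 1 := by
    have : hypTime w ^ 2 * (1 / hypTime w ^ 2) = 1 := by field_simp
    linear_combination this - hypTime w ^ 2 * hnw
  have e1 : α + β * Real.cosh d = Real.cosh s := by
    rw [hα, hβ, Real.sinh_sub]
    field_simp
    ring
  have e2 : α * Real.cosh d + β = Real.cosh (d - s) := by
    rw [hα, hβ, Real.sinh_sub, Real.cosh_sub]
    field_simp
    have := Real.cosh_sq d
    linear_combination -Real.sinh s * this
  have e3 : α ^ 2 + β ^ 2 + 2 * α * β * Real.cosh d = 1 := by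
    have h1 : α * Real.cosh s + β * Real.cosh (d - s) = 1 := by
      rw [hα, hβ]
      have := Real.sinh_add (d - s) s
      rw [sub_add_cancel] at this
      field_simp
      linarith
    linear_combination h1 + α * e1 + β * e2
  rw [lorentz] at hcosh
  obtain ⟨m, h0, h1, h2⟩ := exists_hyperboloid_point
    (x₀ := α * hypTime z + β * hypTime w)
    (x₁ := α * (hypTime z * (klein z).re) + β * (hypTime w * (klein w).re))
    (x₂ := α * (hypTime z * (klein z).im) + β * (hypTime w * (klein w).im)) (by positivity) (by
      linear_combination e3 + α ^ 2 * hnz' + β ^ 2 * hnw' - 2 * α * β * hcosh)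
  refine ⟨m, eq_of_cosh_eq dist_nonneg hs0 ?_, eq_of_cosh_eq dist_nonneg (by linarith) ?_⟩
  · rw [cosh_dist_eq_of_coords h0 h1 h2, ← e1]
    linear_combination α * hnz' - β * hcosh
  · rw [dist_comm, cosh_dist_eq_of_coords h0 h1 h2, ← e2]
    linear_combination β * hnw' - α * hcosh

/-- The geodesic with given end points on the circle at infinity. -/
theorem exists_line {p q : ℂ} (hp : ‖p‖ = 1) (hq : ‖q‖ = 1) (hpq : p ≠ q) :
    ∃ c : ℝ → ℍ, Isometry c ∧ ∃ A > 0, ∀ z t, Real.cosh (dist z (c t)) =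
      A * hypTime z * (Real.exp t * lorentz (klein z) p + Real.exp (-t) * lorentz (klein z) q) := by
  have hκ : 0 < lorentz p q := by
    have h := norm_sub_sq_eq p q
    have h1 : 0 < ‖p - q‖ := norm_pos_iff.2 (sub_ne_zero.2 hpq)
    rw [hp, hq] at h
    nlinarith
  -- The line is the vector `A * (exp t * (1, p) + exp (-t) * (1, q))`. Since `(1, p)` and `(1, q)`
  -- are null, its Lorentz square is `2 * A ^ 2 * lorentz p q`, which `A` normalizes to 1.
  set A := (√(2 * lorentz p q))⁻¹ with hA
  have hA0 : 0 < A := by positivity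
  have hA2 : A ^ 2 * (2 * lorentz p q) = 1 := by
    rw [hA, inv_pow, Real.sq_sqrt (by positivity)]
    field_simp
  have hp2 : p.re * p.re + p.im * p.im = 1 := by
    rw [← Complex.normSq_apply, ← Complex.sq_norm, hp, one_pow]
  have hq2 : q.re * q.re + q.im * q.im = 1 := by
    rw [← Complex.normSq_apply, ← Complex.sq_norm, hq, one_pow]
  have hexp : ∀ t : ℝ, Real.exp t * Real.exp (-t) = 1 := fun t => by
    rw [← Real.exp_add, add_neg_cancel, Real.exp_zero]
  rw [lorentz] at hA2
  choose c h0 h1 h2 using fun t : ℝ => exists_hyperboloid_point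
    (x₀ := A * (Real.exp t + Real.exp (-t)))
    (x₁ := A * (Real.exp t * p.re + Real.exp (-t) * q.re))
    (x₂ := A * (Real.exp t * p.im + Real.exp (-t) * q.im)) (by positivity) (by
      linear_combination hA2 - A ^ 2 * Real.exp t ^ 2 * hp2 - A ^ 2 * Real.exp (-t) ^ 2 * hq2 +
        2 * A ^ 2 * (1 - p.re * q.re - p.im * q.im) * hexp t)
  refine ⟨c, Isometry.of_dist_eq fun s t => ?_, A, hA0, fun z t => ?_⟩
  · refine eq_of_cosh_eq dist_nonneg dist_nonneg ?_
    rw [Real.dist_eq, Real.cosh_abs, Real.cosh_eq (s - t), cosh_dist_eq_of_coords (h0 t) (h1 t) (h2 t)]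
    have e1 : Real.exp (s - t) = Real.exp s * Real.exp (-t) := by
      rw [← Real.exp_add, sub_eq_add_neg]
    have e2 : Real.exp (-(s - t)) = Real.exp (-s) * Real.exp t := by
      rw [← Real.exp_add]; ring_nf
    rw [e1, e2]
    linear_combination A * (Real.exp t + Real.exp (-t)) * h0 s -
      A * (Real.exp t * p.re + Real.exp (-t) * q.re) * h1 s -
      A * (Real.exp t * p.im + Real.exp (-t) * q.im) * h2 s -
      A ^ 2 * Real.exp s * Real.exp t * hp2 - A ^ 2 * Real.exp (-s) * Real.exp (-t) * hq2 +
      (Real.exp s * Real.exp (-t) + Real.exp (-s) * Real.exp t) / 2 * hA2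
  · rw [cosh_dist_eq_of_coords (h0 t) (h1 t) (h2 t)]
    unfold lorentz
    ring

end Hyperboloid

/-! ### Sequences of positive speed and their ends -/

section Tracking

theorem eventually_le_exp_mul (K : ℝ) {ε : ℝ} (hε : 0 < ε) :
    ∀ᶠ n : ℕ in atTop, K ≤ Real.exp (ε * n) :=
  (Real.tendsto_exp_atTop.comp
    (tendsto_natCast_atTop_atTop.const_mul_atTop hε)).eventually_ge_atTop K

theorem half_exp_le_cosh (x : ℝ) : Real.exp x / 2 ≤ Real.cosh x := by
  rw [Real.cosh_eq]
  have := Real.exp_pos (-x)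
  linarith

theorem cosh_le_exp {x : ℝ} (hx : 0 ≤ x) : Real.cosh x ≤ Real.exp x := by
  rw [Real.cosh_eq]
  have : Real.exp (-x) ≤ Real.exp x := Real.exp_le_exp.2 (by linarith)
  linarith

/-- Sublinear distance follows from subexponential growth of its hyperbolic cosine, a form in which
constant factors are absorbed by a fraction of `ε`. -/
theorem tendsto_div_zero_of_cosh_le {d : ℕ → ℝ} (hd : ∀ n, 0 ≤ d n)
    (h : ∀ ε > 0, ∀ᶠ n : ℕ in atTop, Real.cosh (d n) ≤ Real.exp (ε * n)) :
    Tendsto (fun n : ℕ => d n / n) atTop (𝓝 0) := by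
  refine tendsto_order.2 ⟨fun c hc => Eventually.of_forall fun n =>
    hc.trans_le (div_nonneg (hd n) n.cast_nonneg), fun c hc => ?_⟩
  filter_upwards [h (c / 3) (by positivity), eventually_le_exp_mul 2 (ε := c / 3) (by positivity),
    eventually_gt_atTop 0] with n h1 h2 hn
  have hn' : (0 : ℝ) < n := by exact_mod_cast hn
  have h3 := half_exp_le_cosh (d n)
  have h4 : Real.exp (d n) ≤ Real.exp (c / 3 * n + c / 3 * n) := by
    rw [Real.exp_add]
    nlinarith [Real.exp_pos (c / 3 * n)]
  have h5 := Real.exp_le_exp.1 h4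
  rw [div_lt_iff₀ hn']
  nlinarith

/-- The sequence `z` goes at speed `v` to the point `p` of the circle at infinity. -/
structure ConvergesAtSpeed (z : ℕ → ℍ) (v : ℝ) (p : ℂ) : Prop where
  norm_eq_one : ‖p‖ = 1
  speed : Tendsto (fun n : ℕ => dist I (z n) / n) atTop (𝓝 v)
  klein_sub_le : ∀ ε > 0, ∀ᶠ n : ℕ in atTop, ‖klein (z n) - p‖ ≤ Real.exp (-((v - ε) * n))

theorem eventually_dist_bounds {z : ℕ → ℍ} {v : ℝ}
    (h : Tendsto (fun n : ℕ => dist I (z n) / n) atTop (𝓝 v)) {ε : ℝ} (hε : 0 < ε) :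
    ∀ᶠ n : ℕ in atTop, (v - ε) * n ≤ dist I (z n) ∧ dist I (z n) ≤ (v + ε) * n := by
  filter_upwards [h.eventually_const_lt (show v - ε < v by linarith),
    h.eventually_lt_const (show v < v + ε by linarith), eventually_gt_atTop 0] with n h1 h2 hn
  have hn' : (0 : ℝ) < n := by exact_mod_cast hn
  rw [lt_div_iff₀ hn'] at h1
  rw [div_lt_iff₀ hn'] at h2
  exact ⟨h1.le, h2.le⟩

theorem inv_hypTime_sq_le {z : ℍ} {r : ℝ} (h : r ≤ dist I z) :
    1 / hypTime z ^ 2 ≤ 4 * Real.exp (-r) ^ 2 := by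
  have h1 := half_exp_le_cosh (dist I z)
  rw [← hypTime_eq_cosh] at h1
  have h2 : Real.exp r ≤ Real.exp (dist I z) := Real.exp_le_exp.2 h
  have h3 : Real.exp r * Real.exp (-r) = 1 := by rw [← Real.exp_add, add_neg_cancel, Real.exp_zero]
  have h4 := hypTime_pos z
  rw [div_le_iff₀ (by positivity)]
  have h5 : 1 ≤ 2 * hypTime z * Real.exp (-r) := by
    rw [← h3]
    gcongr
    linarith
  nlinarith

/-- The Lorentz product is `cosh (dist z w)` divided by both time coordinates, each of which is at
least `exp r / 2`. This contraction makes the Klein coordinates converge. -/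
theorem norm_klein_sub_klein_le {z w : ℍ} {r C : ℝ} (hz : r ≤ dist I z) (hw : r ≤ dist I w)
    (hC : dist z w ≤ C) :
    ‖klein z - klein w‖ ≤ √(8 * Real.cosh C) * Real.exp (-r) := by
  have h1 := inv_hypTime_sq_le hz
  have h2 := inv_hypTime_sq_le hw
  have h3 := norm_sub_sq_eq (klein z) (klein w)
  have h4 := cosh_dist_eq z w
  have h5 : Real.cosh (dist z w) ≤ Real.cosh C :=
    Real.cosh_le_cosh.2 (by
      rw [abs_of_nonneg dist_nonneg, abs_of_nonneg (dist_nonneg.trans hC)]; exact hC)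
  have hz0 := hypTime_pos z
  have hw0 := hypTime_pos w
  have h6 : lorentz (klein z) (klein w) =
      Real.cosh (dist z w) * ((1 / hypTime z) * (1 / hypTime w)) := by
    rw [h4]; field_simp
  have h7 : (1 / hypTime z) * (1 / hypTime w) ≤ 4 * Real.exp (-r) ^ 2 := by
    rw [← one_div_pow] at h1 h2
    nlinarith [sq_nonneg (1 / hypTime z - 1 / hypTime w)]
  have h8 : lorentz (klein z) (klein w) ≤ Real.cosh C * (4 * Real.exp (-r) ^ 2) := by
    rw [h6]
    have := Real.cosh_pos C
    gcongr
  refine (sq_le_sq₀ (norm_nonneg _) (by positivity)).1 ?_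
  rw [mul_pow, Real.sq_sqrt (by have := Real.cosh_pos C; positivity), h3, norm_klein_sq,
    norm_klein_sq]
  have : 0 < 1 / hypTime z ^ 2 := by positivity
  have : 0 < 1 / hypTime w ^ 2 := by positivity
  nlinarith

/-- The Klein steps are eventually dominated by a geometric series of ratio `exp (-(v - δ))`. The
limit lies on the circle because the time coordinate tends to infinity, and the tail of the series
gives the rate. -/
theorem exists_convergesAtSpeed {z : ℕ → ℍ} {v C : ℝ} (hv : 0 < v)
    (hC : ∀ n, dist (z n) (z (n + 1)) ≤ C)
    (h : Tendsto (fun n : ℕ => dist I (z n) / n) atTop (𝓝 v)) :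
    ∃ p, ConvergesAtSpeed z v p := by
  set K := √(8 * Real.cosh C) with hK
  have step : ∀ δ > 0, δ < v → ∃ N, ∀ k, dist (klein (z (k + N))) (klein (z (k + 1 + N))) ≤
      K * Real.exp (-((v - δ) * N)) * Real.exp (-(v - δ)) ^ k := fun δ hδ hδv => by
    obtain ⟨N, hN⟩ := eventually_atTop.1 (eventually_dist_bounds h hδ)
    refine ⟨N, fun k => ?_⟩
    have h1 := (hN (k + N) (by linarith)).1
    have h2 := (hN (k + 1 + N) (by linarith)).1
    have h3 : (v - δ) * (k + N : ℕ) ≤ dist I (z (k + 1 + N)) := by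
      refine le_trans ?_ h2
      have : 0 < v - δ := by linarith
      gcongr
      omega
    have h4 := norm_klein_sub_klein_le (C := C) h1 h3 (by
      have := hC (k + N)
      rwa [add_right_comm] at this)
    rw [← hK] at h4
    rw [dist_eq_norm, mul_assoc, ← Real.exp_nat_mul, ← Real.exp_add]
    refine h4.trans_eq ?_
    push_cast
    ring_nf
  have hlt : ∀ δ, δ < v → Real.exp (-(v - δ)) < 1 := fun δ hδ =>
    Real.exp_lt_one_iff.2 (by linarith)
  obtain ⟨p, hp⟩ : ∃ p, Tendsto (fun n => klein (z n)) atTop (𝓝 p) := by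
    obtain ⟨N, hN⟩ := step (v / 2) (by positivity) (by linarith)
    obtain ⟨p, hp⟩ := cauchySeq_tendsto_of_complete
      (cauchySeq_of_le_geometric _ _ (hlt (v / 2) (by linarith)) hN)
    exact ⟨p, (tendsto_add_atTop_iff_nat N).1 hp⟩
  refine ⟨p, ?_, h, fun ε hε => ?_⟩
  · have h1 : Tendsto (fun n : ℕ => 1 / hypTime (z n) ^ 2) atTop (𝓝 0) := by
      have h2 : Tendsto (fun n : ℕ => 4 * Real.exp (-(v / 2 * n)) ^ 2) atTop (𝓝 (4 * 0 ^ 2)) := by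
        refine (Tendsto.pow (Real.tendsto_exp_atBot.comp ?_) 2).const_mul 4
        exact tendsto_neg_atTop_atBot.comp
          (tendsto_natCast_atTop_atTop.const_mul_atTop (by positivity))
      refine squeeze_zero' (Eventually.of_forall fun n => by positivity) ?_ (by simpa using h2)
      filter_upwards [eventually_dist_bounds h (half_pos hv)] with n hn
      exact inv_hypTime_sq_le (by linarith [hn.1])
    have h2 : Tendsto (fun n => ‖klein (z n)‖ ^ 2) atTop (𝓝 1) := by
      simp only [norm_klein_sq]
      simpa using h1.const_sub 1
    have h3 := tendsto_nhds_unique h2 (hp.norm.pow 2)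
    nlinarith [norm_nonneg p]
  · set δ := min ε v / 2 with hδ
    have hm : 0 < min ε v := lt_min hε hv
    have hδ0 : 0 < δ := by positivity
    have hδv : δ < v := by linarith [min_le_right ε v]
    have hδε : δ < ε := by linarith [min_le_left ε v]
    obtain ⟨N, hN⟩ := step δ hδ0 hδv
    have hb := dist_le_of_le_geometric_of_tendsto _ _ (hlt δ hδv) hN
      ((tendsto_add_atTop_iff_nat N).2 hp)
    filter_upwards [eventually_le_exp_mul (K / (1 - Real.exp (-(v - δ)))) (sub_pos.2 hδε),
      eventually_ge_atTop N] with n h1 hn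
    obtain ⟨k, rfl⟩ : ∃ k, n = k + N := ⟨n - N, by omega⟩
    have h2 := hb k
    rw [dist_eq_norm] at h2
    calc _ ≤ _ := h2
      _ = K / (1 - Real.exp (-(v - δ))) * Real.exp (-((v - δ) * (k + N : ℕ))) := by
        rw [mul_div_right_comm, mul_div_right_comm, mul_assoc, ← Real.exp_nat_mul, ← Real.exp_add]
        push_cast
        ring_nf
      _ ≤ Real.exp ((ε - δ) * (k + N : ℕ)) * Real.exp (-((v - δ) * (k + N : ℕ))) := by
        gcongr
      _ = _ := by
        rw [← Real.exp_add]
        ring_nf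

namespace ConvergesAtSpeed

theorem lorentz_le {z : ℕ → ℍ} {v : ℝ} {p : ℂ} (h : ConvergesAtSpeed z v p) {ε : ℝ} (hε : 0 < ε) :
    ∀ᶠ n : ℕ in atTop, lorentz (klein (z n)) p ≤ 3 * Real.exp (-((v - ε) * n)) ^ 2 := by
  filter_upwards [h.klein_sub_le ε hε, eventually_dist_bounds h.speed hε] with n h1 h2
  have h3 := inv_hypTime_sq_le h2.1
  have h4 := norm_sub_sq_eq (klein (z n)) p
  rw [norm_klein_sq, h.norm_eq_one] at h4
  nlinarith [norm_nonneg (klein (z n) - p)]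

/-- The geodesic with positive end point `p` tracks the sequences going to `p`. -/
theorem tendsto_dist_line {z : ℕ → ℍ} {v : ℝ} {p q : ℂ} (h : ConvergesAtSpeed z v p)
    (hq : ‖q‖ = 1) {c : ℝ → ℍ} {A : ℝ} (hA : 0 < A)
    (hc : ∀ z t, Real.cosh (dist z (c t)) = A * hypTime z *
      (Real.exp t * lorentz (klein z) p + Real.exp (-t) * lorentz (klein z) q)) :
    Tendsto (fun n : ℕ => dist (z n) (c (n * v)) / n) atTop (𝓝 0) := by
  refine tendsto_div_zero_of_cosh_le (fun n => dist_nonneg) fun ε hε => ?_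
  -- The time coordinate costs `ε / 4`, the squared decay of the Lorentz product with `p` costs
  -- twice that, and the factor `5 * A` the last quarter.
  have hε4 : 0 < ε / 4 := by positivity
  filter_upwards [h.lorentz_le hε4, eventually_dist_bounds h.speed hε4,
    eventually_le_exp_mul (5 * A) hε4] with n h1 h2 h3
  have h4 : hypTime (z n) ≤ Real.exp ((v + ε / 4) * n) := by
    rw [hypTime_eq_cosh]
    exact (cosh_le_exp dist_nonneg).trans (Real.exp_le_exp.2 h2.2)
  have h5 := lorentz_le_two (norm_klein_le_one (z n)) hq.le
  have hn : (0 : ℝ) ≤ n := n.cast_nonneg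
  have ht := hypTime_pos (z n)
  rw [hc]
  calc A * hypTime (z n) * (Real.exp (n * v) * lorentz (klein (z n)) p +
          Real.exp (-(n * v)) * lorentz (klein (z n)) q)
      ≤ A * hypTime (z n) * (Real.exp (n * v) * (3 * Real.exp (-((v - ε / 4) * n)) ^ 2) +
          Real.exp (-(n * v)) * 2) := by gcongr
    _ ≤ A * Real.exp ((v + ε / 4) * n) * (Real.exp (n * v) *
          (3 * Real.exp (-((v - ε / 4) * n)) ^ 2) + Real.exp (-(n * v)) * 2) := by gcongr
    _ = A * (3 * Real.exp (3 * (ε / 4 * n)) + 2 * Real.exp (ε / 4 * n)) := by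
        have e1 : Real.exp ((v + ε / 4) * n) * Real.exp (n * v) *
            Real.exp (-((v - ε / 4) * n)) ^ 2 = Real.exp (3 * (ε / 4 * n)) := by
          rw [← Real.exp_nat_mul, ← Real.exp_add, ← Real.exp_add]
          push_cast
          ring_nf
        have e2 : Real.exp ((v + ε / 4) * n) * Real.exp (-(n * v)) = Real.exp (ε / 4 * n) := by
          rw [← Real.exp_add]
          ring_nf
        linear_combination 3 * A * e1 + 2 * A * e2
    _ ≤ A * (3 * Real.exp (3 * (ε / 4 * n)) + 2 * Real.exp (3 * (ε / 4 * n))) := by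
        have : 0 ≤ ε / 4 * n := by positivity
        have := Real.exp_le_exp.2 (show ε / 4 * n ≤ 3 * (ε / 4 * n) by linarith)
        gcongr
    _ = 5 * A * Real.exp (3 * (ε / 4 * n)) := by ring
    _ ≤ Real.exp (ε / 4 * n) * Real.exp (3 * (ε / 4 * n)) := by gcongr
    _ = Real.exp (ε * n) := by
        rw [← Real.exp_add]
        ring_nf

/-- Two sequences that go at the same speed to the same point at infinity stay close. -/
theorem tendsto_dist_div_zero {z w : ℕ → ℍ} {v : ℝ} {p : ℂ} (hz : ConvergesAtSpeed z v p)
    (hw : ConvergesAtSpeed w v p) :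
    Tendsto (fun n : ℕ => dist (z n) (w n) / n) atTop (𝓝 0) := by
  refine tendsto_div_zero_of_cosh_le (fun n => dist_nonneg) fun ε hε => ?_
  -- Two fifths go to the time coordinates, two to the squared decay `E ^ 2`, one to the factor 6.
  have hε5 : 0 < ε / 5 := by positivity
  filter_upwards [hz.klein_sub_le _ hε5, hw.klein_sub_le _ hε5, eventually_dist_bounds hz.speed hε5,
    eventually_dist_bounds hw.speed hε5, eventually_le_exp_mul 6 hε5] with n h1 h2 h3 h4 h5
  have ht : ∀ {x : ℍ}, dist I x ≤ (v + ε / 5) * n → hypTime x ≤ Real.exp ((v + ε / 5) * n) :=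
    fun {x} hx => by
      rw [hypTime_eq_cosh]
      exact (cosh_le_exp dist_nonneg).trans (Real.exp_le_exp.2 hx)
  have h6 := ht h3.2
  have h7 := ht h4.2
  have h8 := inv_hypTime_sq_le h3.1
  have h9 := inv_hypTime_sq_le h4.1
  have hz0 := hypTime_pos (z n)
  have hw0 := hypTime_pos (w n)
  set u := klein (z n)
  set u' := klein (w n)
  set E := Real.exp (-((v - ε / 5) * n))
  have h10 : ‖u - u'‖ ≤ 2 * E := by
    have : u - u' = (u - p) - (u' - p) := by ring
    rw [this]
    exact (norm_sub_le _ _).trans (by linarith)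
  have h11 : lorentz u u' ≤ 6 * E ^ 2 := by
    have h12 := norm_sub_sq_eq u u'
    rw [norm_klein_sq, norm_klein_sq] at h12
    nlinarith [norm_nonneg (u - u')]
  rw [cosh_dist_eq]
  calc hypTime (z n) * hypTime (w n) * lorentz u u'
      ≤ hypTime (z n) * hypTime (w n) * (6 * E ^ 2) := by gcongr
    _ ≤ Real.exp ((v + ε / 5) * n) * Real.exp ((v + ε / 5) * n) * (6 * E ^ 2) := by gcongr
    _ = 6 * Real.exp (4 * (ε / 5 * n)) := by
        have e1 : Real.exp ((v + ε / 5) * n) * Real.exp ((v + ε / 5) * n) * E ^ 2 =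
            Real.exp (4 * (ε / 5 * n)) := by
          rw [← Real.exp_nat_mul, ← Real.exp_add, ← Real.exp_add]
          push_cast
          ring_nf
        linear_combination 6 * e1
    _ ≤ Real.exp (ε / 5 * n) * Real.exp (4 * (ε / 5 * n)) := by gcongr
    _ = Real.exp (ε * n) := by
        rw [← Real.exp_add]
        ring_nf

end ConvergesAtSpeed

/-- Changing the base point does not change the speed. -/
theorem tendsto_dist_div_of_base {o o' : ℍ} {z : ℕ → ℍ} {v : ℝ}
    (h : Tendsto (fun n : ℕ => dist o (z n) / n) atTop (𝓝 v)) :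
    Tendsto (fun n : ℕ => dist o' (z n) / n) atTop (𝓝 v) := by
  have h0 : Tendsto (fun n : ℕ => dist o' (z n) / n - dist o (z n) / n) atTop (𝓝 0) := by
    refine squeeze_zero_norm (fun n => ?_) (tendsto_const_div_atTop_nhds_zero_nat (dist o' o))
    rw [← sub_div, norm_div, Real.norm_natCast]
    gcongr
    exact abs_dist_sub_le o' o (z n)
  simpa using h0.add h

/-- The geodesic line whose ends are the limits of two sequences of positive speed that drift
apart, parametrized so that its origin is the point closest to a given one. -/
theorem exists_tracking_line {z w : ℕ → ℍ} {o : ℍ} {v C : ℝ} (hv : 0 < v)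
    (hzC : ∀ n, dist (z n) (z (n + 1)) ≤ C) (hwC : ∀ n, dist (w n) (w (n + 1)) ≤ C)
    (hz : Tendsto (fun n : ℕ => dist o (z n) / n) atTop (𝓝 v))
    (hw : Tendsto (fun n : ℕ => dist o (w n) / n) atTop (𝓝 v))
    (hzw : ¬ Tendsto (fun n : ℕ => dist (z n) (w n) / n) atTop (𝓝 0)) :
    ∃ c : ℝ → ℍ, Isometry c ∧ (∀ t, dist o (c 0) ≤ dist o (c t)) ∧
      Tendsto (fun n : ℕ => dist (z n) (c (n * v)) / n) atTop (𝓝 0) ∧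
      Tendsto (fun n : ℕ => dist (w n) (c (-(n * v))) / n) atTop (𝓝 0) := by
  obtain ⟨p, hp⟩ := exists_convergesAtSpeed hv hzC (tendsto_dist_div_of_base hz)
  obtain ⟨q, hq⟩ := exists_convergesAtSpeed hv hwC (tendsto_dist_div_of_base hw)
  have hpq : p ≠ q := fun h => hzw (hp.tendsto_dist_div_zero (h ▸ hq))
  obtain ⟨c, hc, A, hA, hcA⟩ := exists_line hp.norm_eq_one hq.norm_eq_one hpq
  have h1 := hp.tendsto_dist_line hq.norm_eq_one hA hcA
  have h2 := hq.tendsto_dist_line hp.norm_eq_one hA (c := fun t => c (-t)) fun z t => by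
    rw [hcA, neg_neg, add_comm]
  -- A closest point exists because the line is proper; moving the origin there changes distances by
  -- at most `|t₀|`, negligible after division by `n`.
  obtain ⟨t₀, ht₀⟩ : ∃ t₀, ∀ t, dist o (c t₀) ≤ dist o (c t) := by
    refine Continuous.exists_forall_le (continuous_const.dist hc.continuous) ?_
    refine tendsto_atTop_mono (f := fun t => |t| - dist o (c 0)) (fun t => ?_)
      (tendsto_atTop_add_const_right _ _ (tendsto_norm_cocompact_atTop (E := ℝ)))
    have h3 : dist (c t) (c 0) = |t| := by rw [hc.dist_eq, Real.dist_eq, sub_zero]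
    have h4 := dist_triangle_left (c t) (c 0) o
    linarith
  have shift : ∀ {x : ℕ → ℍ} {s : ℕ → ℝ},
      Tendsto (fun n : ℕ => dist (x n) (c (s n)) / n) atTop (𝓝 0) →
      Tendsto (fun n : ℕ => dist (x n) (c (s n + t₀)) / n) atTop (𝓝 0) := fun {x s} h => by
    have h3 := h.add (tendsto_const_div_atTop_nhds_zero_nat |t₀|)
    rw [add_zero] at h3
    refine squeeze_zero (fun n => by positivity) (fun n => ?_) h3
    rw [← add_div]
    gcongr
    refine (dist_triangle _ (c (s n)) _).trans_eq ?_
    rw [hc.dist_eq, Real.dist_eq]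
    simp
  refine ⟨fun t => c (t + t₀), hc.comp (IsometryEquiv.addRight t₀).isometry, fun t => ?_,
    shift h1, shift h2⟩
  simpa using ht₀ (t + t₀)

end Tracking

/-! ### Additivity of the homology class -/

section HomologyClass

variable {Γ : Type*} [Group Γ]

theorem homologyClass_mul (a b : Γ) :
    homologyClass (a * b) = homologyClass a + homologyClass b := by
  simp only [homologyClass, map_mul, ofMul_mul]
  exact TensorProduct.tmul_add _ _ _

theorem homologyClass_one : homologyClass (1 : Γ) = 0 := by
  have h := homologyClass_mul (1 : Γ) 1
  rwa [mul_one, left_eq_add] at h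

theorem homologyClass_inv (a : Γ) : homologyClass a⁻¹ = -homologyClass a := by
  rw [eq_neg_iff_add_eq_zero, ← homologyClass_mul, inv_mul_cancel, homologyClass_one]

end HomologyClass

/-! ### Covering group, word length and tiles -/

section SurfaceGroup

variable {Γ : Type*} [Group Γ] [MulAction Γ ℍ]

theorem proj_eq_proj_iff {z w : ℍ} : proj Γ z = proj Γ w ↔ ∃ g : Γ, g • w = z :=
  Quotient.eq (r := MulAction.orbitRel Γ ℍ)

theorem proj_smul (g : Γ) (z : ℍ) : proj Γ (g • z) = proj Γ z := proj_eq_proj_iff.2 ⟨g, rfl⟩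

theorem isQuotientMap_proj : IsQuotientMap (proj Γ) :=
  isQuotientMap_quotient_mk' (s := MulAction.orbitRel Γ ℍ)

theorem continuous_proj : Continuous (proj Γ) := isQuotientMap_proj.continuous

theorem proj_surjective : Function.Surjective (proj Γ) := isQuotientMap_proj.surjective

namespace IsClosedSurfaceGroup

theorem dist_smul_smul (hΓ : IsClosedSurfaceGroup Γ) (g : Γ) (z w : ℍ) :
    dist (g • z) (g • w) = dist z w := by
  obtain ⟨A, hA⟩ := hΓ.moebius g
  rw [hA, hA, dist_smul]

theorem isIsometricSMul (hΓ : IsClosedSurfaceGroup Γ) : IsIsometricSMul Γ ℍ :=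
  ⟨fun g => Isometry.of_dist_eq (hΓ.dist_smul_smul g)⟩

theorem continuous_smul (hΓ : IsClosedSurfaceGroup Γ) (g : Γ) : Continuous fun z : ℍ => g • z :=
  (Isometry.of_dist_eq (hΓ.dist_smul_smul g)).continuous

theorem t2Space (hΓ : IsClosedSurfaceGroup Γ) : T2Space (Surface Γ) := by
  have := hΓ.isIsometricSMul
  have : ProperlyDiscontinuousSMul Γ ℍ :=
    ⟨fun {K L} hK hL => (hΓ.properlyDiscontinuous _ (hK.union hL)).subset (by
      rintro g ⟨_, ⟨z, hz, rfl⟩, hgz⟩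
      exact ⟨z, .inl hz, .inr hgz⟩)⟩
  exact t2Space_of_properlyDiscontinuousSMul_of_t2Space (Γ := Γ) (T := ℍ)

theorem finite_dist_le (hΓ : IsClosedSurfaceGroup Γ) (o : ℍ) (R : ℝ) :
    {g : Γ | dist o (g • o) ≤ R}.Finite := by
  rcases lt_or_ge R 0 with hR | hR
  · convert Set.finite_empty
    ext g
    simpa using hR.trans_le dist_nonneg
  · refine (hΓ.properlyDiscontinuous _ (isCompact_closedBall o R)).subset fun g hg => ?_
    exact ⟨o, Metric.mem_closedBall_self hR, by rw [Metric.mem_closedBall, dist_comm]; exact hg⟩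

theorem exists_covering_radius (hΓ : IsClosedSurfaceGroup Γ) (o : ℍ) :
    ∃ R, 0 ≤ R ∧ ∀ z, ∃ g : Γ, dist z (g • o) ≤ R := by
  obtain ⟨K, hK, hcov⟩ := hΓ.cocompact
  obtain ⟨R, hR⟩ := hK.isBounded.subset_closedBall o
  refine ⟨max R 0, le_max_right _ _, fun z => ?_⟩
  obtain ⟨g, hg⟩ := hcov z
  refine ⟨g⁻¹, ?_⟩
  rw [← hΓ.dist_smul_smul g, smul_inv_smul]
  exact (Metric.mem_closedBall.1 (hR hg)).trans (le_max_left _ _)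

/-- The word length of a covering transformation is at most comparable with its displacement. -/
theorem exists_finite_word_length_le (hΓ : IsClosedSurfaceGroup Γ) (o : ℍ) :
    ∃ S : Set Γ, S.Finite ∧ ∀ (n : ℕ) (g : Γ), dist o (g • o) ≤ n →
      ∃ l : List Γ, l.length ≤ n + 1 ∧ (∀ s ∈ l, s ∈ S) ∧ l.prod = g := by
  obtain ⟨R, hR0, hR⟩ := hΓ.exists_covering_radius o
  refine ⟨_, hΓ.finite_dist_le o (2 * R + 1), ?_⟩
  -- Walk from `z` back to `o` by steps of length at most 1, keeping an orbit point of `o` within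
  -- `R`. Consecutive orbit points are at most `2 * R + 1` apart, hence differ by an element of the
  -- finite set.
  have key : ∀ (n : ℕ) (z : ℍ) (g : Γ), dist o z ≤ n → dist z (g • o) ≤ R →
      ∃ l : List Γ, l.length ≤ n + 1 ∧ (∀ s ∈ l, dist o (s • o) ≤ 2 * R + 1) ∧ l.prod = g := by
    intro n
    induction n with
    | zero =>
      intro z g hz hg
      refine ⟨[g], by simp, fun s hs => ?_, by simp⟩
      rw [List.mem_singleton] at hs
      subst hs
      have := dist_triangle o z (s • o)
      push_cast at hz
      linarith
    | succ n ih =>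
      intro z g hz hg
      obtain ⟨m, hm1, hm2⟩ : ∃ m, dist o m ≤ n ∧ dist m z ≤ 1 := by
        push_cast at hz
        rcases le_total (dist o z) n with h | h
        · exact ⟨z, h, by simp⟩
        · obtain ⟨m, h1, h2⟩ := exists_dist_eq_of_le_dist o z n.cast_nonneg h
          exact ⟨m, h1.le, by linarith⟩
      obtain ⟨k, hk⟩ := hR m
      obtain ⟨l, hl, hlS, hlk⟩ := ih m k hm1 hk
      refine ⟨l ++ [k⁻¹ * g], by simpa using hl, fun s hs => ?_, by simp [hlk]⟩
      rw [List.mem_append, List.mem_singleton] at hs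
      rcases hs with hs | rfl
      · exact hlS s hs
      · rw [← hΓ.dist_smul_smul k, mul_smul, smul_inv_smul]
        have h1 := dist_triangle (k • o) m (g • o)
        have h2 := dist_triangle m z (g • o)
        rw [dist_comm (k • o) m] at h1
        linarith
  exact fun n g hg => key n (g • o) g hg (by simpa using hR0)

theorem group_fg (hΓ : IsClosedSurfaceGroup Γ) : Group.FG Γ := by
  obtain ⟨S, hS, h⟩ := hΓ.exists_finite_word_length_le I
  refine Group.fg_iff.2 ⟨S, (Subgroup.eq_top_iff' _).2 fun g => ?_, hS⟩
  obtain ⟨n, hn⟩ := exists_nat_ge (dist I (g • I))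
  obtain ⟨l, -, hl, rfl⟩ := h n g hn
  exact Subgroup.list_prod_mem _ fun s hs => Subgroup.subset_closure (hl s hs)

/-- Finite generation of Γ gives this; it provides the completeness used for integrals with values
in the homology. -/
theorem finiteDimensional_H1 (hΓ : IsClosedSurfaceGroup Γ) : FiniteDimensional ℝ (H1 Γ) := by
  have := hΓ.group_fg
  have : Group.FG (Abelianization Γ) := Group.fg_of_surjective (f := Abelianization.of)
    (QuotientGroup.mk'_surjective _)
  have : Module.Finite ℤ (Additive (Abelianization Γ)) :=
    Module.Finite.iff_addGroup_fg.2 inferInstance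
  exact Module.Finite.base_change ℤ ℝ (Additive (Abelianization Γ))

/-- The class of a word is the sum of the classes of its letters, which are bounded on a finite set.
The 2 covers the extra letter and the rounding of the distance. -/
theorem exists_norm_homologyClass_le (hΓ : IsClosedSurfaceGroup Γ) (o : ℍ) :
    ∃ M, 0 ≤ M ∧ ∀ g : Γ, ‖homologyClass g‖ ≤ M * (dist o (g • o) + 2) := by
  obtain ⟨S, hS, h⟩ := hΓ.exists_finite_word_length_le o
  obtain ⟨M, hM⟩ := (hS.image fun s => ‖homologyClass s‖).bddAbove
  refine ⟨max M 0, le_max_right _ _, fun g => ?_⟩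
  obtain ⟨l, hl, hlS, rfl⟩ := h ⌈dist o (g • o)⌉₊ g (Nat.le_ceil _)
  have key : ∀ l : List Γ, (∀ s ∈ l, s ∈ S) → ‖homologyClass l.prod‖ ≤ max M 0 * l.length := by
    intro l
    induction l with
    | nil => simp [homologyClass_one]
    | cons a l ih =>
      intro hl
      rw [List.prod_cons, homologyClass_mul, List.length_cons]
      have h1 := ih fun s hs => hl s (List.mem_cons_of_mem _ hs)
      have h2 : ‖homologyClass a‖ ≤ max M 0 :=
        (hM (Set.mem_image_of_mem _ (hl a List.mem_cons_self))).trans (le_max_left _ _)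
      refine (norm_add_le _ _).trans ?_
      push_cast
      linarith
  refine (key l hlS).trans ?_
  gcongr
  have h1 : (l.length : ℝ) ≤ ⌈dist o (l.prod • o)⌉₊ + 1 := by exact_mod_cast hl
  have h2 := Nat.ceil_lt_add_one (dist_nonneg (x := o) (y := l.prod • o))
  linarith

end IsClosedSurfaceGroup

namespace IsBoundedFundamentalDomain

variable {D E : Set ℍ}

theorem tile_spec (hD : IsBoundedFundamentalDomain Γ D) (z : ℍ) : (tile D z : Γ)⁻¹ • z ∈ D :=
  Classical.epsilon_spec (hD.partition z).exists

theorem eq_tile (hD : IsBoundedFundamentalDomain Γ D) {z : ℍ} {g : Γ} (h : g⁻¹ • z ∈ D) :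
    g = tile D z :=
  (hD.partition z).unique h (hD.tile_spec z)

theorem tile_smul (hD : IsBoundedFundamentalDomain Γ D) (g : Γ) (z : ℍ) :
    (tile D (g • z) : Γ) = g * tile D z := by
  refine (hD.eq_tile ?_).symm
  rw [mul_inv_rev, mul_smul, inv_smul_smul]
  exact hD.tile_spec z

theorem exists_mem_proj_eq (hD : IsBoundedFundamentalDomain Γ D) (y : Surface Γ) :
    ∃ z ∈ D, proj Γ z = y := by
  obtain ⟨z, rfl⟩ := proj_surjective y
  exact ⟨_, hD.tile_spec z, proj_smul _ _⟩

theorem liftTo_mem (hD : IsBoundedFundamentalDomain Γ D) (y : Surface Γ) : liftTo D y ∈ D :=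
  (Classical.epsilon_spec (hD.exists_mem_proj_eq y)).1

theorem proj_liftTo (hD : IsBoundedFundamentalDomain Γ D) (y : Surface Γ) :
    proj Γ (liftTo D y) = y :=
  (Classical.epsilon_spec (hD.exists_mem_proj_eq y)).2

theorem injOn_proj (hD : IsBoundedFundamentalDomain Γ D) : Set.InjOn (proj Γ) D := by
  intro z hz w hw h
  obtain ⟨g, rfl⟩ := proj_eq_proj_iff.1 h
  have h1 : (1 : Γ) = tile D w := hD.eq_tile (by simpa using hw)
  have h2 : g⁻¹ = tile D w := hD.eq_tile (by simpa using hz)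
  rw [← h1, inv_eq_one] at h2
  rw [h2, one_smul]

/-- The homology classes of the tiles of two points differ at most by a multiple of the distance
of the points. -/
theorem exists_norm_tile_sub_tile_le (hΓ : IsClosedSurfaceGroup Γ)
    (hD : IsBoundedFundamentalDomain Γ D) (hE : IsBoundedFundamentalDomain Γ E) :
    ∃ M B, 0 ≤ M ∧ ∀ z w : ℍ,
      ‖homologyClass (tile D z : Γ) - homologyClass (tile E w : Γ)‖ ≤ M * dist z w + B := by
  obtain ⟨M, hM0, hM⟩ := hΓ.exists_norm_homologyClass_le I
  obtain ⟨r, hr⟩ := hD.bounded.subset_closedBall I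
  obtain ⟨s, hs⟩ := hE.bounded.subset_closedBall I
  refine ⟨M, M * (r + s + 2), hM0, fun z w => ?_⟩
  set g : Γ := tile D z
  set h : Γ := tile E w
  have h1 : dist z (g • I) ≤ r := by
    rw [← hΓ.dist_smul_smul g⁻¹, inv_smul_smul]
    exact hr (hD.tile_spec z)
  have h2 : dist w (h • I) ≤ s := by
    rw [← hΓ.dist_smul_smul h⁻¹, inv_smul_smul]
    exact hs (hE.tile_spec w)
  have h3 : dist I ((h⁻¹ * g) • I) ≤ dist z w + r + s := by
    rw [← hΓ.dist_smul_smul h, mul_smul, smul_inv_smul]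
    have h4 := dist_triangle4 (h • I) w z (g • I)
    rw [dist_comm (h • I) w, dist_comm w z] at h4
    linarith
  have h4 : homologyClass g - homologyClass h = homologyClass (h⁻¹ * g) := by
    rw [homologyClass_mul, homologyClass_inv]
    abel
  rw [h4]
  refine (hM _).trans ?_
  nlinarith

/-- The conditions force `b` to be the inverse of the tile of `c 0` and `a * b⁻¹` to be the tile of
`c t`. -/
theorem curveClass_eq (hE : IsBoundedFundamentalDomain Γ E) (c : ℝ → ℍ) (t : ℝ) :
    curveClass (Γ := Γ) E c t =
      homologyClass (tile E (c t) : Γ) - homologyClass (tile E (c 0) : Γ) := by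
  have hex : ∃ a b : Γ, (b * a⁻¹) • c t ∈ E ∧ b • c 0 ∈ E :=
    ⟨tile E (c t) * (tile E (c 0))⁻¹, (tile E (c 0))⁻¹, by simpa using hE.tile_spec (c t),
      hE.tile_spec (c 0)⟩
  obtain ⟨b, h1, h2⟩ := Classical.epsilon_spec hex
  rw [curveClass]
  set a := Classical.epsilon fun a : Γ => ∃ b : Γ, (b * a⁻¹) • c t ∈ E ∧ b • c 0 ∈ E
  have h3 : b⁻¹ = tile E (c 0) := hE.eq_tile (by simpa using h2)
  have h4 : a * b⁻¹ = tile E (c t) := hE.eq_tile (by simpa using h1)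
  rw [← h3, ← h4, homologyClass_mul, add_sub_cancel_right]

end IsBoundedFundamentalDomain

end SurfaceGroup

/-! ### Local isometry of the covering and lifts of geodesics -/

section LocalIsometry

variable {Γ : Type*} [Group Γ] [MulAction Γ ℍ]

theorem surfaceDist_proj_le (z w : ℍ) : surfaceDist Γ (proj Γ z) (proj Γ w) ≤ dist z w :=
  csInf_le ⟨0, by rintro _ ⟨_, _, -, -, rfl⟩; exact dist_nonneg⟩ ⟨z, w, rfl, rfl, rfl⟩

namespace IsClosedSurfaceGroup

theorem exists_pos_le_dist_smul (hΓ : IsClosedSurfaceGroup Γ) (z : ℍ) :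
    ∃ ε > 0, ∀ g : Γ, g ≠ 1 → ε ≤ dist z (g • z) := by
  have hfin : ((fun g : Γ => dist z (g • z)) '' ({g : Γ | dist z (g • z) ≤ 1} \ {1})).Finite :=
    ((hΓ.finite_dist_le z 1).subset Set.sdiff_subset).image _
  obtain ⟨ε, hε, h⟩ : ∃ ε > 0, ∀ g : Γ, dist z (g • z) ≤ 1 → g ≠ 1 → ε ≤ dist z (g • z) := by
    rcases Set.eq_empty_or_nonempty
      ((fun g : Γ => dist z (g • z)) '' ({g : Γ | dist z (g • z) ≤ 1} \ {1})) with he | hne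
    · refine ⟨1, one_pos, fun g h1 h2 => ?_⟩
      have : g ∈ ({g : Γ | dist z (g • z) ≤ 1} \ {1}) := ⟨h1, h2⟩
      rw [Set.image_eq_empty] at he
      simp [he] at this
    · obtain ⟨_, ⟨g, ⟨hg1, hg2⟩, rfl⟩, hmin⟩ := hfin.exists_minimal hne
      refine ⟨dist z (g • z), dist_pos.2 fun h => hg2 (hΓ.free g z h.symm), fun k hk1 hk2 => ?_⟩
      rcases le_total (dist z (k • z)) (dist z (g • z)) with h | h
      · exact hmin ⟨k, ⟨hk1, hk2⟩, rfl⟩ h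
      · exact h
  refine ⟨min ε 1, lt_min hε one_pos, fun g hg => ?_⟩
  rcases le_total (dist z (g • z)) 1 with h1 | h1
  · exact (min_le_left _ _).trans (h g h1 hg)
  · exact (min_le_right _ _).trans h1

/-- The covering projection is a local isometry. -/
theorem exists_surfaceDist_proj_eq (hΓ : IsClosedSurfaceGroup Γ) (o : ℍ) :
    ∃ δ > 0, ∀ z w : ℍ, dist o z < δ → dist o w < δ →
      surfaceDist Γ (proj Γ z) (proj Γ w) = dist z w := by
  obtain ⟨ε, hε, h⟩ := hΓ.exists_pos_le_dist_smul o
  -- A nontrivial translate of `w` is more than `ε / 2` away from `z`, whereas `z` and `w` are less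
  -- than `ε / 2` apart.
  refine ⟨ε / 4, by positivity, fun z w hz hw => (surfaceDist_proj_le z w).antisymm ?_⟩
  refine le_csInf ⟨_, z, w, rfl, rfl, rfl⟩ ?_
  rintro _ ⟨z', w', hz', hw', rfl⟩
  obtain ⟨g, rfl⟩ := proj_eq_proj_iff.1 hz'
  obtain ⟨k, rfl⟩ := proj_eq_proj_iff.1 hw'
  rw [← hΓ.dist_smul_smul g⁻¹ (g • z), inv_smul_smul, ← mul_smul]
  by_cases hk : g⁻¹ * k = 1
  · rw [hk, one_smul]
  · have h1 := h _ hk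
    have h2 := dist_triangle4 o z ((g⁻¹ * k) • w) ((g⁻¹ * k) • o)
    rw [hΓ.dist_smul_smul, dist_comm w o] at h2
    have h3 := dist_triangle_left z w o
    linarith

theorem isGeodesic_proj (hΓ : IsClosedSurfaceGroup Γ) {c : ℝ → ℍ} (hc : Isometry c) :
    IsGeodesic fun t => proj Γ (c t) := by
  intro t
  obtain ⟨δ, hδ, h⟩ := hΓ.exists_surfaceDist_proj_eq (c t)
  refine ⟨δ, hδ, fun s s' hs hs' => ?_⟩
  rw [h, hc.dist_eq, Real.dist_eq]
  · rwa [hc.dist_eq, dist_comm, Real.dist_eq]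
  · rwa [hc.dist_eq, dist_comm, Real.dist_eq]

/-- The lifts of the geodesics of the surface do not increase distances. -/
theorem dist_curveLift_le (hΓ : IsClosedSurfaceGroup Γ) {γ : ℝ → Surface Γ} (hγ : IsGeodesic γ)
    {c : ℝ → ℍ} (hc : IsCurveLift γ c) {a b : ℝ} (hab : a ≤ b) : dist (c a) (c b) ≤ b - a := by
  have hloc : ∀ t, ∀ᶠ s in 𝓝[>] t, dist (c t) (c s) ≤ s - t := fun t => by
    obtain ⟨δ, hδ, h⟩ := hΓ.exists_surfaceDist_proj_eq (c t)
    obtain ⟨ε, hε, hγt⟩ := hγ t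
    have h1 : ∀ᶠ s in 𝓝 t, dist (c s) (c t) < δ :=
      hc.1.continuousAt.eventually (Metric.ball_mem_nhds _ hδ)
    have h2 : ∀ᶠ s in 𝓝 t, |s - t| < ε := Metric.ball_mem_nhds t hε
    filter_upwards [h1.filter_mono nhdsWithin_le_nhds, h2.filter_mono nhdsWithin_le_nhds,
      self_mem_nhdsWithin] with s hs1 hs2 hs3
    rw [← h _ _ (by simpa using hδ) (by rwa [dist_comm]), hc.2, hc.2,
      hγt t s (by simpa using hε) hs2, abs_sub_comm, abs_of_pos (sub_pos.2 hs3)]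
  -- The local estimate bounds the right slopes of the distance to `c a` by 1; the mean value
  -- inequality makes this global.
  refine image_le_of_liminf_slope_right_le_deriv_boundary (f := fun t => dist (c a) (c t))
    (a := a) (b := b) (B := fun t => t - a) (B' := fun _ => 1)
    (continuous_const.dist hc.1).continuousOn (by simp) (by fun_prop)
    (fun t _ => ((hasDerivAt_id t).sub_const a).hasDerivWithinAt) (fun t _ r hr => ?_)
    (Set.right_mem_Icc.2 hab)
  refine Eventually.frequently ?_
  filter_upwards [hloc t, self_mem_nhdsWithin] with s hs hs'
  have h3 : 0 < s - t := sub_pos.2 hs'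
  rw [slope_def_field, div_lt_iff₀ h3]
  have h4 := dist_triangle (c a) (c t) (c s)
  nlinarith

end IsClosedSurfaceGroup

end LocalIsometry

/-- Birkhoff's ergodic theorem for vector valued functions that factor through a function with
finitely many values. -/
theorem tendsto_birkhoffSum_comp {X ι V : Type*} [MeasurableSpace X] [NormedAddCommGroup V]
    [NormedSpace ℝ V] [CompleteSpace V] {μ : Measure X} [IsProbabilityMeasure μ] {T : X → X}
    (hT : Ergodic T μ) {φ : X → ι} (hfin : (Set.range φ).Finite)
    (hφ : ∀ i, MeasurableSet (φ ⁻¹' {i})) (G : ι → V) :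
    ∀ᵐ x ∂μ, Tendsto (fun n : ℕ => (n : ℝ)⁻¹ • birkhoffSum T (fun y => G (φ y)) n x) atTop
      (𝓝 (∫ y, G (φ y) ∂μ)) := by
  classical
  let g : ι → X → ℝ := fun i => (φ ⁻¹' {i}).indicator 1
  have hg : ∀ i, Measurable (g i) := fun i => measurable_one.indicator (hφ i)
  have hg0 : ∀ i x, 0 ≤ g i x := fun i x => Set.indicator_nonneg (fun _ _ => zero_le_one) _
  have hg1 : ∀ i x, g i x ≤ 1 := fun i x => Set.indicator_le_self' (fun _ _ => zero_le_one) x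
  have hsum : ∀ x, G (φ x) = ∑ i ∈ hfin.toFinset, g i x • G i := fun x => by
    rw [Finset.sum_eq_single (φ x)]
    · simp [g]
    · intro i _ hi
      have : x ∉ φ ⁻¹' {i} := fun h => hi (Set.mem_singleton_iff.1 h).symm
      simp [g, Set.indicator_of_notMem this]
    · intro h
      simp at h
  have hint : ∫ y, G (φ y) ∂μ = ∑ i ∈ hfin.toFinset, (∫ y, g i y ∂μ) • G i := by
    rw [integral_congr_ae (ae_of_all _ hsum), integral_finsetSum (f := fun i y => g i y • G i) _ fun i _ =>
      (integrable_of_bounded (hg i) (hg0 i) (hg1 i)).smul_const (G i)]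
    exact Finset.sum_congr rfl fun i _ => integral_smul_const _ _
  have hbirk : ∀ (n : ℕ) x, (n : ℝ)⁻¹ • birkhoffSum T (fun y => G (φ y)) n x =
      ∑ i ∈ hfin.toFinset, (birkhoffSum T (g i) n x / n) • G i := fun n x => by
    simp only [birkhoffSum, hsum]
    rw [Finset.sum_comm, Finset.smul_sum]
    refine Finset.sum_congr rfl fun i _ => ?_
    rw [← Finset.sum_smul, smul_smul, div_eq_inv_mul]
  have hall := (ae_ball_iff hfin.toFinset.countable_toSet).2 fun i _ =>
    tendsto_birkhoffSum_div hT (hg i) (hg0 i) (hg1 i)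
  filter_upwards [hall] with x hx
  rw [hint]
  simp_rw [hbirk]
  exact tendsto_finsetSum _ fun i hi => (hx i hi).smul_const (G i)

/-! ### Displacement and homology cocycles of the lift -/

section PreferredLift

variable {Γ : Type*} [Group Γ] [MulAction Γ ℍ] {f : Surface Γ ≃ₜ Surface Γ} {ft : ℍ ≃ₜ ℍ}

namespace IsPreferredLift

theorem symm (hft : IsPreferredLift f ft) : IsPreferredLift f.symm ft.symm :=
  ⟨fun z => by rw [Homeomorph.eq_symm_apply, ← hft.1, ft.apply_symm_apply],
    fun g z => by rw [Homeomorph.symm_apply_eq, hft.2, ft.apply_symm_apply]⟩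

theorem iterate_smul (hft : IsPreferredLift f ft) (n : ℕ) (g : Γ) (z : ℍ) :
    ft^[n] (g • z) = g • ft^[n] z :=
  (Function.Commute.iterate_left (g := fun z : ℍ => g • z) (hft.2 g) n) z

theorem proj_iterate (hft : IsPreferredLift f ft) (n : ℕ) (z : ℍ) :
    proj Γ (ft^[n] z) = f^[n] (proj Γ z) :=
  (Function.Semiconj.iterate_right (f := proj Γ) hft.1 n) z

/-- The displacement is continuous and Γ-invariant, and the action is cocompact. -/
theorem exists_dist_le (hΓ : IsClosedSurfaceGroup Γ) (hft : IsPreferredLift f ft) :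
    ∃ C, ∀ z, dist z (ft z) ≤ C := by
  obtain ⟨R, -, hR⟩ := hΓ.exists_covering_radius I
  obtain ⟨C, hC⟩ := ((isCompact_closedBall I R).image
    (continuous_id.dist ft.continuous)).bddAbove
  refine ⟨C, fun z => ?_⟩
  obtain ⟨g, hg⟩ := hR z
  rw [← hΓ.dist_smul_smul g⁻¹, ← hft.2]
  refine hC ⟨g⁻¹ • z, ?_, rfl⟩
  rwa [Metric.mem_closedBall, ← hΓ.dist_smul_smul g, smul_inv_smul]

theorem rotationDist_proj (hΓ : IsClosedSurfaceGroup Γ) (hft : IsPreferredLift f ft) (n : ℕ)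
    (z : ℍ) : rotationDist ft n (proj Γ z) = dist z (ft^[n] z) := by
  have h : proj Γ (Quotient.out (proj Γ z)) = proj Γ z := Quotient.out_eq _
  obtain ⟨g, hg⟩ := proj_eq_proj_iff.1 h
  rw [rotationDist, ← hg, hft.iterate_smul, hΓ.dist_smul_smul]

theorem rotationDist_symm_iterate (hΓ : IsClosedSurfaceGroup Γ) (hft : IsPreferredLift f ft)
    (n : ℕ) (z : ℍ) :
    rotationDist ft n (f.symm^[n] (proj Γ z)) = dist z (ft.symm^[n] z) := by
  rw [← hft.symm.proj_iterate, hft.rotationDist_proj hΓ,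
    (Function.LeftInverse.iterate ft.apply_symm_apply n) z, dist_comm]

theorem isBoundedSubadditive_rotationDist (hΓ : IsClosedSurfaceGroup Γ)
    (hft : IsPreferredLift f ft) {C : ℝ} (hC : ∀ z, dist z (ft z) ≤ C) :
    IsBoundedSubadditive f C (rotationDist (Γ := Γ) ft) where
  measurable n := by
    refine Continuous.measurable (isQuotientMap_proj.continuous_iff.2 ?_)
    have : rotationDist ft n ∘ proj Γ = fun z => dist z (ft^[n] z) :=
      funext fun z => hft.rotationDist_proj hΓ n z
    rw [this]
    exact continuous_id.dist (ft.continuous.iterate n)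
  nonneg _ _ := dist_nonneg
  le n x := by
    obtain ⟨z, rfl⟩ := proj_surjective x
    rw [hft.rotationDist_proj hΓ]
    induction n with
    | zero => simp
    | succ n ih =>
      rw [Function.iterate_succ_apply']
      push_cast
      linarith [dist_triangle z (ft^[n] z) (ft (ft^[n] z)), hC (ft^[n] z)]
  subadd m n x := by
    obtain ⟨z, rfl⟩ := proj_surjective x
    rw [← hft.proj_iterate, hft.rotationDist_proj hΓ, hft.rotationDist_proj hΓ,
      hft.rotationDist_proj hΓ, add_comm m n, Function.iterate_add_apply]
    exact dist_triangle _ _ _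

variable {D : Set ℍ}

/-- Bring `z` into `D` by the inverse of its tile and use equivariance. Tiles along an orbit are
therefore products of cocycle values, which become Birkhoff sums in homology. -/
theorem tile_apply (hft : IsPreferredLift f ft) (hD : IsBoundedFundamentalDomain Γ D) (z : ℍ) :
    (tile D (ft z) : Γ) = tile D z * rotationCocycle D ft (proj Γ z) := by
  have h : (tile D z : Γ)⁻¹ • z = liftTo D (proj Γ z) :=
    hD.injOn_proj (hD.tile_spec z) (hD.liftTo_mem _) (by rw [hD.proj_liftTo, proj_smul])
  rw [rotationCocycle, ← h, hft.2, hD.tile_smul, mul_inv_cancel_left]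

theorem homologyClass_tile_iterate (hft : IsPreferredLift f ft)
    (hD : IsBoundedFundamentalDomain Γ D) (n : ℕ) (z : ℍ) :
    homologyClass (tile D (ft^[n] z) : Γ) = homologyClass (tile D z : Γ) +
      birkhoffSum f (fun y => homologyClass (rotationCocycle D ft y)) n (proj Γ z) := by
  induction n with
  | zero => simp
  | succ n ih =>
    rw [Function.iterate_succ_apply', hft.tile_apply hD, homologyClass_mul, ih, birkhoffSum_succ,
      hft.proj_iterate, add_assoc]

theorem homologyClass_tile_symm_iterate (hft : IsPreferredLift f ft)
    (hD : IsBoundedFundamentalDomain Γ D) (n : ℕ) (z : ℍ) :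
    homologyClass (tile D (ft.symm^[n] z) : Γ) = homologyClass (tile D z : Γ) -
      birkhoffSum f.symm (fun y => homologyClass (rotationCocycle D ft (f.symm y))) n
        (proj Γ z) := by
  induction n with
  | zero => simp
  | succ n ih =>
    have h := hft.tile_apply hD (ft.symm^[n + 1] z)
    rw [Function.iterate_succ_apply', ft.apply_symm_apply] at h
    rw [h, homologyClass_mul, hft.symm.1, hft.symm.proj_iterate] at ih
    rw [Function.iterate_succ_apply', birkhoffSum_succ, ← sub_sub, ← ih, add_sub_cancel_right]

/-- A point of `D` moves by at most `C`, so `a_y` displaces `I` by at most `r + C + r`; proper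
discontinuity leaves finitely many elements. -/
theorem finite_range_rotationCocycle (hΓ : IsClosedSurfaceGroup Γ) (hft : IsPreferredLift f ft)
    (hD : IsBoundedFundamentalDomain Γ D) :
    (Set.range (rotationCocycle (Γ := Γ) D ft)).Finite := by
  obtain ⟨C, hC⟩ := hft.exists_dist_le hΓ
  obtain ⟨r, hr⟩ := hD.bounded.subset_closedBall I
  refine (hΓ.finite_dist_le I (r + C + r)).subset ?_
  rintro _ ⟨y, rfl⟩
  have h1 : dist (liftTo D y) I ≤ r := hr (hD.liftTo_mem y)
  have h2 : dist ((rotationCocycle D ft y)⁻¹ • ft (liftTo D y)) I ≤ r := hr (hD.tile_spec _)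
  rw [← hΓ.dist_smul_smul (rotationCocycle D ft y), smul_inv_smul] at h2
  have h3 := dist_triangle4 I (liftTo D y) (ft (liftTo D y)) (rotationCocycle D ft y • I)
  rw [dist_comm I (liftTo D y)] at h3
  exact h3.trans (add_le_add (add_le_add h1 (hC _)) h2)

/-- The preimage is the image of a Borel subset of `D`, where the projection is injective, and
injective continuous images of Borel sets are Borel (Lusin–Souslin). -/
theorem measurableSet_rotationCocycle_preimage (hΓ : IsClosedSurfaceGroup Γ)
    (hD : IsBoundedFundamentalDomain Γ D) (hDm : MeasurableSet D) (g : Γ) :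
    MeasurableSet (rotationCocycle D ft ⁻¹' {g}) := by
  have := hΓ.t2Space
  have heq : rotationCocycle D ft ⁻¹' {g} =
      proj Γ '' (D ∩ (fun z => g⁻¹ • ft z) ⁻¹' D) := by
    ext y
    constructor
    · intro hy
      refine ⟨liftTo D y, ⟨hD.liftTo_mem y, ?_⟩, hD.proj_liftTo y⟩
      rw [← Set.mem_singleton_iff.1 hy]
      exact hD.tile_spec _
    · rintro ⟨z, ⟨hz, hz'⟩, rfl⟩
      have h : liftTo D (proj Γ z) = z :=
        hD.injOn_proj (hD.liftTo_mem _) hz (hD.proj_liftTo _)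
      rw [Set.mem_preimage, rotationCocycle, h]
      exact (hD.eq_tile hz').symm
  rw [heq]
  refine (hDm.inter (((hΓ.continuous_smul g⁻¹).comp ft.continuous).measurable hDm)
    ).image_of_continuousOn_injOn continuous_proj.continuousOn
    (hD.injOn_proj.mono Set.inter_subset_left)

end IsPreferredLift

end PreferredLift

/-! ### Homological drift and tracking geodesics -/

variable {Γ : Type*} [Group Γ] [MulAction Γ ℍ] {f : Surface Γ ≃ₜ Surface Γ} {ft : ℍ ≃ₜ ℍ}
  {D E : Set ℍ}

/-- The homology classes of the tiles grow at most at the speed of the points. -/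
theorem tendsto_homologyClass_tile_sub (hΓ : IsClosedSurfaceGroup Γ)
    (hD : IsBoundedFundamentalDomain Γ D) (hE : IsBoundedFundamentalDomain Γ E) {z w : ℕ → ℍ}
    (h : Tendsto (fun n : ℕ => dist (z n) (w n) / n) atTop (𝓝 0)) :
    Tendsto (fun n : ℕ => (n : ℝ)⁻¹ •
      (homologyClass (tile D (z n) : Γ) - homologyClass (tile E (w n) : Γ))) atTop (𝓝 0) := by
  obtain ⟨M, B, -, hMB⟩ := hD.exists_norm_tile_sub_tile_le hΓ hE
  have h1 := (h.const_mul M).add (tendsto_const_div_atTop_nhds_zero_nat B)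
  rw [mul_zero, add_zero] at h1
  refine squeeze_zero_norm (fun n => ?_) h1
  rw [norm_smul, norm_inv, Real.norm_natCast, ← mul_div_assoc, ← add_div, div_eq_inv_mul]
  gcongr
  exact hMB _ _

theorem tendsto_inv_natCast_smul_const {V : Type*} [NormedAddCommGroup V] [NormedSpace ℝ V]
    (h : V) : Tendsto (fun n : ℕ => (n : ℝ)⁻¹ • h) atTop (𝓝 0) := by
  simpa using (tendsto_inv_atTop_nhds_zero_nat (𝕜 := ℝ)).smul_const h

namespace IsPreferredLift

theorem tendsto_homologyClass_tile_iterate (hft : IsPreferredLift f ft)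
    (hD : IsBoundedFundamentalDomain Γ D) {z : ℍ} {ρ : H1 Γ}
    (h : Tendsto (fun n : ℕ => (n : ℝ)⁻¹ • birkhoffSum f
      (fun y => homologyClass (rotationCocycle D ft y)) n (proj Γ z)) atTop (𝓝 ρ)) :
    Tendsto (fun n : ℕ => (n : ℝ)⁻¹ • homologyClass (tile D (ft^[n] z) : Γ)) atTop (𝓝 ρ) := by
  simp only [hft.homologyClass_tile_iterate hD, smul_add]
  simpa using (tendsto_inv_natCast_smul_const (homologyClass (tile D z : Γ))).add h

theorem tendsto_homologyClass_tile_symm_iterate (hft : IsPreferredLift f ft)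
    (hD : IsBoundedFundamentalDomain Γ D) {z : ℍ} {ρ : H1 Γ}
    (h : Tendsto (fun n : ℕ => (n : ℝ)⁻¹ • birkhoffSum f.symm
      (fun y => homologyClass (rotationCocycle D ft (f.symm y))) n (proj Γ z)) atTop (𝓝 ρ)) :
    Tendsto (fun n : ℕ => (n : ℝ)⁻¹ • homologyClass (tile D (ft.symm^[n] z) : Γ)) atTop
      (𝓝 (-ρ)) := by
  simp only [hft.homologyClass_tile_symm_iterate hD, smul_sub]
  simpa using (tendsto_inv_natCast_smul_const (homologyClass (tile D z : Γ))).sub h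

/-- Homology drifts at most `M` times as fast as points move; nonzero drift therefore forces
positive speed. -/
theorem norm_le_of_tendsto_homologyClass_tile (hΓ : IsClosedSurfaceGroup Γ)
    (hD : IsBoundedFundamentalDomain Γ D) :
    ∃ M, 0 ≤ M ∧ ∀ {ρ : H1 Γ} {v : ℝ} {z : ℍ} {w : ℕ → ℍ},
      Tendsto (fun n : ℕ => (n : ℝ)⁻¹ • homologyClass (tile D (w n) : Γ)) atTop (𝓝 ρ) →
      Tendsto (fun n : ℕ => dist z (w n) / n) atTop (𝓝 v) → ‖ρ‖ ≤ M * v := by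
  obtain ⟨M, B, hM, hMB⟩ := hD.exists_norm_tile_sub_tile_le hΓ hD
  refine ⟨M, hM, fun {ρ v z w} h hv => ?_⟩
  have h1 := h.sub (tendsto_inv_natCast_smul_const (homologyClass (tile D z : Γ)))
  have h2 := (hv.const_mul M).add (tendsto_const_div_atTop_nhds_zero_nat B)
  rw [sub_zero] at h1
  rw [add_zero] at h2
  refine le_of_tendsto_of_tendsto' h1.norm h2 fun n => ?_
  rw [← smul_sub, norm_smul, norm_inv, Real.norm_natCast, ← mul_div_assoc, ← add_div,
    div_eq_inv_mul, norm_sub_rev]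
  gcongr
  exact hMB _ _

/-- A point whose orbit has positive speed and drifts in homology in opposite directions in the
past and in the future has a normalized tracking geodesic. -/
theorem exists_isNormalizedTrackingGeodesic (hΓ : IsClosedSurfaceGroup Γ)
    (hft : IsPreferredLift f ft) (hD : IsBoundedFundamentalDomain Γ D) {z : ℍ} {v : ℝ}
    (hv : 0 < v) (hspeed : HasRotationSpeed f ft (proj Γ z) v) {ρ : H1 Γ} (hρ : ρ ≠ 0)
    (hfwd : Tendsto (fun n : ℕ => (n : ℝ)⁻¹ • homologyClass (tile D (ft^[n] z) : Γ)) atTop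
      (𝓝 ρ))
    (hbwd : Tendsto (fun n : ℕ => (n : ℝ)⁻¹ • homologyClass (tile D (ft.symm^[n] z) : Γ)) atTop
      (𝓝 (-ρ))) :
    ∃ γ : ℝ → Surface Γ, IsNormalizedTrackingGeodesic f ft (proj Γ z) v γ := by
  obtain ⟨C, hC⟩ := hft.exists_dist_le hΓ
  have h1 := hspeed.1
  have h2 := hspeed.2
  simp only [hft.rotationDist_proj hΓ] at h1
  simp only [hft.rotationDist_symm_iterate hΓ] at h2
  -- Sublinearly close half orbits would have equal drifts, so that `ρ = -ρ`.
  have hdrift : ¬ Tendsto (fun n : ℕ => dist (ft^[n] z) (ft.symm^[n] z) / n) atTop (𝓝 0) := by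
    intro h
    have h3 := tendsto_homologyClass_tile_sub hΓ hD hD h
    simp only [smul_sub] at h3
    have h4 := tendsto_nhds_unique (hfwd.sub hbwd) h3
    rw [sub_neg_eq_add, ← two_smul ℝ, smul_eq_zero] at h4
    exact hρ (h4.resolve_left two_ne_zero)
  obtain ⟨c, hc, hmin, hc1, hc2⟩ := exists_tracking_line (C := C) hv
    (fun n => by rw [Function.iterate_succ_apply']; exact hC _)
    (fun n => by
      rw [Function.iterate_succ_apply', dist_comm]
      simpa using hC (ft.symm (ft.symm^[n] z))) h1 h2 hdrift
  have hlift : ∀ g : Γ, IsCurveLift (fun t => proj Γ (c t)) fun t => g • c t := fun g =>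
    ⟨(hΓ.continuous_smul g).comp hc.continuous, fun t => proj_smul g (c t)⟩
  refine ⟨fun t => proj Γ (c t), ⟨hspeed, hv, hΓ.isGeodesic_proj hc, fun z' hz' => ?_⟩,
    z, c, rfl, ⟨hc.continuous, fun _ => rfl⟩, ⟨hc1, hc2⟩, ?_⟩
  · obtain ⟨g, rfl⟩ := proj_eq_proj_iff.1 hz'
    refine ⟨fun t => g • c t, hlift g, ?_, ?_⟩
    · simpa only [hft.iterate_smul, hΓ.dist_smul_smul] using hc1
    · simpa only [hft.symm.iterate_smul, hΓ.dist_smul_smul] using hc2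
  · refine le_antisymm ?_ (Metric.infDist_le_dist_of_mem (Set.mem_range_self 0))
    refine (Metric.le_infDist (Set.range_nonempty c)).2 ?_
    rintro _ ⟨t, rfl⟩
    exact hmin t

end IsPreferredLift

/-- The homology of a curve that tracks at speed `v` a sequence with asymptotic homology `ρ`. -/
theorem hasAsymptoticClass_of_tracks (hΓ : IsClosedSurfaceGroup Γ)
    (hD : IsBoundedFundamentalDomain Γ D) (hE : IsBoundedFundamentalDomain Γ E)
    {γ : ℝ → Surface Γ} (hγ : IsGeodesic γ) {c : ℝ → ℍ} (hc : IsCurveLift γ c) {v : ℝ} (hv : 0 < v)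
    {z : ℕ → ℍ} {ρ : H1 Γ}
    (hz : Tendsto (fun n : ℕ => (n : ℝ)⁻¹ • homologyClass (tile D (z n) : Γ)) atTop (𝓝 ρ))
    (hcz : Tendsto (fun n : ℕ => dist (z n) (c (n * v)) / n) atTop (𝓝 0)) :
    HasAsymptoticClass E c (v⁻¹ • ρ) := by
  have h1 := tendsto_homologyClass_tile_sub hΓ hD hE hcz
  simp only [smul_sub] at h1
  have h2 : Tendsto (fun n : ℕ => (n : ℝ)⁻¹ • homologyClass (tile E (c (n * v)) : Γ)) atTop
      (𝓝 ρ) := by simpa using hz.sub h1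
  -- Tracking controls the curve only at multiples of `v`. For real `t` use the multiple given by
  -- `⌊t / v⌋₊`, at distance at most `v` since lifts of geodesics are 1-Lipschitz.
  have hfloor : Tendsto (fun t : ℝ => ⌊t / v⌋₊) atTop atTop :=
    tendsto_nat_floor_atTop.comp (tendsto_id.atTop_div_const hv)
  have hratio : Tendsto (fun t : ℝ => t⁻¹ * ⌊t / v⌋₊) atTop (𝓝 v⁻¹) := by
    have h3 := (tendsto_nat_floor_div_atTop (R := ℝ)).comp (tendsto_id.atTop_div_const hv)
    have h4 := h3.mul_const v⁻¹
    rw [one_mul] at h4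
    refine h4.congr fun t => ?_
    simp only [Function.comp_apply, id_eq]
    field_simp
  have h3 := hratio.smul (h2.comp hfloor)
  obtain ⟨M, B, hM, hMB⟩ := hE.exists_norm_tile_sub_tile_le hΓ hE
  have h4 : Tendsto (fun t : ℝ => t⁻¹ • (homologyClass (tile E (c t) : Γ) -
      homologyClass (tile E (c (⌊t / v⌋₊ * v)) : Γ))) atTop (𝓝 0) := by
    have h5 : Tendsto (fun t : ℝ => t⁻¹ * (M * v + B)) atTop (𝓝 0) := by
      simpa using tendsto_inv_atTop_zero.mul_const (M * v + B)
    refine squeeze_zero_norm' ?_ h5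
    filter_upwards [eventually_gt_atTop 0] with t ht
    rw [norm_smul, norm_inv, Real.norm_of_nonneg ht.le]
    have h6 : (⌊t / v⌋₊ : ℝ) * v ≤ t :=
      (le_div_iff₀ hv).1 (Nat.floor_le (by positivity))
    have h7 : t - ⌊t / v⌋₊ * v ≤ v := by
      have := (div_lt_iff₀ hv).1 (Nat.lt_floor_add_one (t / v))
      linarith
    have h8 := (hΓ.dist_curveLift_le hγ hc h6).trans h7
    rw [dist_comm] at h8
    gcongr
    refine (hMB _ _).trans ?_
    gcongr
  have h5 : Tendsto (fun t : ℝ => t⁻¹ • homologyClass (tile E (c 0) : Γ)) atTop (𝓝 0) := by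
    simpa using (tendsto_inv_atTop_zero (𝕜 := ℝ)).smul_const (homologyClass (tile E (c 0) : Γ))
  have h6 := (h3.add h4).sub h5
  rw [add_zero, sub_zero] at h6
  refine h6.congr' ?_
  filter_upwards [hfloor.eventually_gt_atTop 0] with t ht
  have ht' : (⌊t / v⌋₊ : ℝ) ≠ 0 := by exact_mod_cast ht.ne'
  rw [hE.curveClass_eq, Function.comp_apply, smul_smul, mul_inv_cancel_right₀ ht', ← smul_add,
    add_sub_cancel, smul_sub]

end TrackingGeodesics

/-! ### The proposition -/

open TrackingGeodesics in
theorem proposition4p5 {Γ : Type*} [Group Γ] [MulAction Γ ℍ] (hΓ : IsClosedSurfaceGroup Γ)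
    (f : Surface Γ ≃ₜ Surface Γ) (hf : IsotopicToId f)
    (ft : ℍ ≃ₜ ℍ) (hft : IsPreferredLift f ft)
    (D : Set ℍ) (hD : IsBoundedFundamentalDomain Γ D) (hDm : MeasurableSet D)
    (E : Set ℍ) (hE : IsBoundedFundamentalDomain Γ E)
    (μ : Measure (Surface Γ)) [IsProbabilityMeasure μ] (hμ : Ergodic f μ)
    (hρ : rotationVector D ft μ ≠ 0) :
    ∃ ϑ : ℝ, MeasureHasRotationSpeed f ft μ ϑ ∧ 0 < ϑ ∧
      ∀ᵐ x ∂μ,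
        (∃ γ : ℝ → Surface Γ, IsNormalizedTrackingGeodesic f ft x ϑ γ) ∧
        ∀ γ : ℝ → Surface Γ, IsTrackingGeodesic f ft x ϑ γ →
          ∀ (z : ℍ) (c : ℝ → ℍ), proj Γ z = x → IsCurveLift γ c → Tracks ft z c ϑ →
            ∃ h : H1 Γ, HasAsymptoticClass E c h ∧ rotationVector D ft μ = ϑ • h := by
  obtain ⟨C, hC⟩ := hft.exists_dist_le hΓ
  have hμ' : Ergodic f.symm μ := Ergodic.symm (e := f.toMeasurableEquiv) hμ
  obtain ⟨v, hv⟩ := (hft.isBoundedSubadditive_rotationDist hΓ hC).exists_tendsto_two_sided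
    (e := f.toMeasurableEquiv) hμ
  have hspeed : MeasureHasRotationSpeed f ft μ v := hv
  have := hΓ.finiteDimensional_H1
  have : CompleteSpace (H1 Γ) := FiniteDimensional.complete ℝ (H1 Γ)
  have hfin := hft.finite_range_rotationCocycle hΓ hD
  have hmeas := IsPreferredLift.measurableSet_rotationCocycle_preimage (ft := ft) hΓ hD hDm
  have hfwd := tendsto_birkhoffSum_comp hμ hfin hmeas homologyClass
  have hbwd := tendsto_birkhoffSum_comp hμ'
    (φ := fun y => rotationCocycle D ft (f.symm y))
    (hfin.subset (by rintro _ ⟨y, rfl⟩; exact ⟨_, rfl⟩))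
    (fun i => f.symm.continuous.measurable (hmeas i)) homologyClass
  -- By invariance the backward averages have the same mean; the opposite sign of the drift comes
  -- from `homologyClass_tile_symm_iterate`.
  rw [hμ'.toMeasurePreserving.integral_comp f.symm.measurableEmbedding
    fun y => homologyClass (rotationCocycle D ft y)] at hbwd
  change ∀ᵐ x ∂μ, Tendsto _ _ (𝓝 (rotationVector D ft μ)) at hfwd hbwd
  have hv0 : 0 < v := by
    obtain ⟨M, hM, hMv⟩ := IsPreferredLift.norm_le_of_tendsto_homologyClass_tile hΓ hD
    obtain ⟨x, hx, hx'⟩ := (hfwd.and hspeed).exists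
    obtain ⟨z, rfl⟩ := proj_surjective x
    have h1 := hx'.1
    simp only [hft.rotationDist_proj hΓ] at h1
    have h2 := hMv (hft.tendsto_homologyClass_tile_iterate hD hx) h1
    by_contra hneg
    push Not at hneg
    exact hρ (norm_le_zero_iff.1 (h2.trans (mul_nonpos_of_nonneg_of_nonpos hM hneg)))
  refine ⟨v, hspeed, hv0, ?_⟩
  filter_upwards [hspeed, hfwd, hbwd] with x hx hx1 hx2
  refine ⟨?_, fun γ hγ z c hz hc hzc => ?_⟩
  · obtain ⟨z, rfl⟩ := proj_surjective x
    exact hft.exists_isNormalizedTrackingGeodesic hΓ hD hv0 hx hρ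
      (hft.tendsto_homologyClass_tile_iterate hD hx1)
      (hft.tendsto_homologyClass_tile_symm_iterate hD hx2)
  · subst hz
    refine ⟨v⁻¹ • rotationVector D ft μ, ?_, by rw [smul_inv_smul₀ hv0.ne']⟩
    exact hasAsymptoticClass_of_tracks hΓ hD hE hγ.geodesic hc hv0
      (hft.tendsto_homologyClass_tile_iterate hD hx1) hzc.1
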